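/- Let $a_n$ be the number of three-dimensional rook paths from $(0,0,0)$ to $(n,n,n)$, that is, of finite sequences of moves with sum $(n,n,n)$, where each move is a positive integer multiple of $(1,0,0)$, $(0,1,0)$ or $(0,0,1)$. Then, as $n\to\infty$, $$a_n \sim \frac{9\sqrt3}{40\pi}\cdot\frac{64^n}{n}.$$ Moreover, let $G(x)=\sum_{n\ge0}a_nx^n$ and $G'(x)=\sum_{n\ge 0}h_nx^n$, so that $h_n=(n+1)a_{n+1}$. The dominant singularity of $G'$ is $x=1/64$: the radius of convergence of $\sum_n h_nx^n$ is $1/64$, and among the points of the circle $|x|=1/64$ the point $x=1/64$ is the only one to a neighbourhood of which $G'$ does not extend analytically. The residue of $G'$ there, in the sense of the coefficient of $1/(1-64x)$, is $$r:=\lim_{\substack{x\to 1/64\\ |x|<1/64}}(1-64x)\,G'(x)=\frac{32}{5}\cdot{}_2F_1\!\left(\tfrac13,\tfrac23;2;1\right)=\frac{72\sqrt3}{5\pi},$$ where ${}_2F_1(a,b;c;z)=\sum_{n\ge0}\frac{(a)_n(b)_n}{(c)_n}\frac{z^n}{n!}$ with $(a)_n=a(a+1)\cdots(a+n-1)$,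 and the coefficients satisfy $h_n\sim r\cdot 64^n$. -/

import Mathlib

open Filter Topology Asymptotics
open scoped Real

namespace Rook3D

/-- The allowed moves: positive integer multiples of `(1,0,0)`, `(0,1,0)` or `(0,0,1)`. -/
def steps : Set (ℕ × ℕ × ℕ) :=
  {s | ∃ n : ℕ, 1 ≤ n ∧ s = (n, 0, 0)} ∪ {s | ∃ n : ℕ, 1 ≤ n ∧ s = (0, n, 0)} ∪
    {s | ∃ n : ℕ, 1 ≤ n ∧ s = (0, 0, n)}

/-- The rook paths from `(0,0,0)` to the cell `p`, each given by its finite sequence of moves. -/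
def paths (p : ℕ × ℕ × ℕ) : Set (List (ℕ × ℕ × ℕ)) :=
  {l | (∀ s ∈ l, s ∈ steps) ∧ l.sum = p}

/-- `r_{i,j,k}`, the number of rook paths from `(0,0,0)` to `(i,j,k)`. -/
noncomputable def numPaths (i j k : ℕ) : ℕ := (paths (i, j, k)).ncard

/-- `a_n = r_{n,n,n}`, the 3D diagonal rook sequence. -/
noncomputable def a (n : ℕ) : ℕ := numPaths n n n

theorem length_le_of_mem_steps (l : List (ℕ × ℕ × ℕ)) (h : ∀ s ∈ l, s ∈ steps) :
    l.length ≤ l.sum.1 + l.sum.2.1 + l.sum.2.2 := by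
  induction l with
  | nil => simp
  | cons x l ih =>
    have h1 := ih fun s hs => h s (List.mem_cons_of_mem _ hs)
    have h2 : 1 ≤ x.1 + x.2.1 + x.2.2 := by
      rcases h x List.mem_cons_self with (⟨n, hn, rfl⟩ | ⟨n, hn, rfl⟩) | ⟨n, hn, rfl⟩ <;> simp [hn]
    simp only [List.length_cons, List.sum_cons, Prod.fst_add, Prod.snd_add]
    omega

/-- There are finitely many rook paths to a given cell, so that `ncard` really counts them. -/
theorem paths_finite (p : ℕ × ℕ × ℕ) : (paths p).Finite := by
  have hfin : Finite (Set.Iic p) := (Set.finite_Iic p).to_subtype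
  refine ((List.finite_length_le (Set.Iic p) (p.1 + p.2.1 + p.2.2)).image
    (List.map Subtype.val)).subset ?_
  rintro l ⟨hl, rfl⟩
  have hle : ∀ s ∈ l, s ∈ Set.Iic l.sum := fun s hs => List.single_le_sum (by simp) s hs
  refine ⟨l.attach.map fun s => ⟨s.1, hle s.1 s.2⟩, ?_, ?_⟩
  · simpa using length_le_of_mem_steps l hl
  · simpa [List.map_map, Function.comp_def] using List.attach_map_subtype_val l

/-- The generating series `G(x) = ∑ a_n x^n` in `ℚ⟦x⟧`. -/
noncomputable def G : PowerSeries ℚ := PowerSeries.mk fun n => (a n : ℚ)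

/-- `h_n`, the coefficient of `x^n` in the derivative `∂_x G`. -/
noncomputable def h (n : ℕ) : ℚ := PowerSeries.coeff n (PowerSeries.derivative ℚ G)

/-- The sum of the complex power series `∑ c_n z^n` extends analytically to a neighbourhood of the
point `ζ` (meant for `ζ` on the boundary of the disc of convergence): some function analytic at `ζ`
agrees with it at the points of the open disc `|z| < |ζ|` that are near `ζ`. -/
def ExtendsAnalyticallyAt (c : ℕ → ℂ) (ζ : ℂ) : Prop :=
  ∃ g : ℂ → ℂ, AnalyticAt ℂ g ζ ∧ ∀ᶠ z in 𝓝 ζ, ‖z‖ < ‖ζ‖ → HasSum (fun n => c n * z ^ n) (g z)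

/-- `ρ` is the dominant singularity of the power series `∑ c_n z^n`: its disc of convergence has
radius `|ρ|`, and `ρ` is the one and only singular point on the boundary circle. -/
def IsDominantSingularity (c : ℕ → ℂ) (ρ : ℂ) : Prop :=
  (FormalMultilinearSeries.ofScalars ℂ c).radius = ENNReal.ofReal ‖ρ‖ ∧
    ∀ ζ : ℂ, ‖ζ‖ = ‖ρ‖ → (¬ ExtendsAnalyticallyAt c ζ ↔ ζ = ρ)

end Rook3D

/-!
The diagonal rook paths are counted by integrals of cubes of Laguerre polynomials. If `p_n(w)` is the
coefficient of `s ^ n` in `exp (w s / (1 - s))` (`laguerre`), then sorting paths by their first move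
and integrating by parts against `exp (-w)` give the same recursion, so that
`a_n = ∫₀^∞ p_n(w) ^ 3 exp (-w) dw` (`numPaths_eq_factorialFunctional`); the integral is replaced by
the linear functional `w ^ k ↦ k!` on polynomials.

Creative telescoping turns this into a recurrence (`recOperator_a`): a combination of the cubes
`p_{n+2} ^ 3, …, p_{n-2} ^ 3` has the form `C' - C` for an explicit `C` without constant term, a cubic
form in `p_n` and `w p_n'`. The recurrence says that `G'` solves a linear differential equation of
second order, whose power series solutions are determined by their constant coefficient
(`eq_zero_of_rookOperator_eq_zero`). The hypergeometric equation, transported along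
`φ(x) = 27 x (2 - 3 x) / (1 - 4 x) ^ 3`, shows that
`6 ₂F₁(1/3, 2/3; 2; φ(x)) / ((1 - 4 x) (1 - 64 x))` is a solution as well; hence it is `G'`
(`derivative_G_eq`).

All analytic claims can be read off from this closed form without singularity analysis. The series of
`φ` has nonnegative coefficients, `φ(1/64) = 1`, and `|φ(x)| < 1` at the other points of the disc
`|x| ≤ 1/64` (`norm_argFun_lt_one`), while the coefficients of `₂F₁(1/3, 2/3; 2; z)` are nonnegative
with a finite sum. So `B(x) = (1 - 64 x) G'(x)` is given by a power series that converges absolutely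
on the closed disc (`evaluatesTo_numeratorSeries`), is continuous there, and continues analytically
across every boundary point but `1/64`. The residue is `B(1/64)`, and `h_n / 64 ^ n` is a partial sum
of the series of `B` at `1/64`, which gives the asymptotics. As `B(1/64) ≠ 0`, the point `1/64` is
singular. Finally, the partial sums of `₂F₁(1/3, 2/3; 2; 1)` have a closed form as products
(`sum_coeff_hypSeries`), whose limit is given by Euler's product for the sine.
-/

namespace Rook3D

/-! ### Rook paths and the factorial functional -/

/-- The coefficient of `s ^ n` in `exp (w s / (1 - s))`, a polynomial in `w`: the Laguerre
polynomial `L_n^{(-1)}(-w)`. -/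
noncomputable def laguerre : ℕ → Polynomial ℚ
  | 0 => 1
  | n + 1 => Polynomial.C ((n + 1 : ℚ)⁻¹) * ((n : Polynomial ℚ) * laguerre n +
      Polynomial.X * (laguerre n + Polynomial.derivative (laguerre n)))

theorem succ_mul_laguerre_succ (n : ℕ) :
    ((n : Polynomial ℚ) + 1) * laguerre (n + 1) = (n : Polynomial ℚ) * laguerre n +
      Polynomial.X * (laguerre n + Polynomial.derivative (laguerre n)) := by
  have h1 : ((n : Polynomial ℚ) + 1) * Polynomial.C ((n + 1 : ℚ)⁻¹) = 1 := by
    rw [show ((n : Polynomial ℚ) + 1) = Polynomial.C (n + 1 : ℚ) by simp, ← Polynomial.C_mul,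
      mul_inv_cancel₀ (by positivity), Polynomial.C_1]
  rw [laguerre, ← mul_assoc, h1, one_mul]

theorem natCast_add_one_ne_zero (n : ℕ) : (n : Polynomial ℚ) + 1 ≠ 0 := by
  exact_mod_cast Nat.succ_ne_zero n

/-- Laguerre's differential equation, and the rule for differentiating `laguerre (n + 1)`; the two
are proved together, since each step of the induction uses both. -/
theorem laguerre_ode_and_derivative_succ (n : ℕ) :
    Polynomial.X * (Polynomial.derivative (Polynomial.derivative (laguerre n)) +
        Polynomial.derivative (laguerre n)) = (n : Polynomial ℚ) * laguerre n ∧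
      Polynomial.derivative (laguerre (n + 1)) =
        Polynomial.derivative (laguerre n) + laguerre n := by
  have key : ∀ n, Polynomial.X * (Polynomial.derivative (Polynomial.derivative (laguerre n)) +
      Polynomial.derivative (laguerre n)) = (n : Polynomial ℚ) * laguerre n →
      Polynomial.derivative (laguerre (n + 1)) =
        Polynomial.derivative (laguerre n) + laguerre n := by
    intro n hn
    have h1 := congrArg Polynomial.derivative (succ_mul_laguerre_succ n)
    simp only [Polynomial.derivative_mul, Polynomial.derivative_add, Polynomial.derivative_natCast,
      Polynomial.derivative_one, Polynomial.derivative_X] at h1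
    exact mul_left_cancel₀ (natCast_add_one_ne_zero n) (by linear_combination h1 + hn)
  induction n with
  | zero => exact ⟨by simp [laguerre], key 0 (by simp [laguerre])⟩
  | succ n ih =>
    have h : Polynomial.X * (Polynomial.derivative (Polynomial.derivative (laguerre (n + 1))) +
        Polynomial.derivative (laguerre (n + 1))) = ((n + 1 : ℕ) : Polynomial ℚ) * laguerre (n + 1) := by
      rw [ih.2, Polynomial.derivative_add]
      push_cast
      linear_combination ih.1 - succ_mul_laguerre_succ n
    exact ⟨h, key _ h⟩

theorem laguerre_ode (n : ℕ) :
    Polynomial.X * (Polynomial.derivative (Polynomial.derivative (laguerre n)) +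
      Polynomial.derivative (laguerre n)) = (n : Polynomial ℚ) * laguerre n :=
  (laguerre_ode_and_derivative_succ n).1

theorem derivative_laguerre_succ (n : ℕ) : Polynomial.derivative (laguerre (n + 1)) =
    Polynomial.derivative (laguerre n) + laguerre n :=
  (laguerre_ode_and_derivative_succ n).2

theorem derivative_laguerre (n : ℕ) :
    Polynomial.derivative (laguerre n) = ∑ m ∈ Finset.range n, laguerre m := by
  induction n with
  | zero => simp [laguerre]
  | succ n ih => rw [derivative_laguerre_succ, Finset.sum_range_succ, ih]

theorem mul_laguerre_eq_sub (n : ℕ) : (n : Polynomial ℚ) * laguerre n =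
    ((n : Polynomial ℚ) + 1) * laguerre (n + 1) -
      Polynomial.X * Polynomial.derivative (laguerre (n + 1)) := by
  rw [derivative_laguerre_succ, succ_mul_laguerre_succ]
  ring

theorem eval_zero_laguerre (n : ℕ) : (laguerre n).eval 0 = if n = 0 then 1 else 0 := by
  induction n with
  | zero => simp [laguerre]
  | succ n ih =>
    rw [laguerre]
    rcases n with _ | n <;> simp_all

/-- The linear functional `w ^ k ↦ k!`, that is `q ↦ ∫₀^∞ q(w) exp (-w) dw`. -/
noncomputable def factorialFunctional : Polynomial ℚ →ₗ[ℚ] ℚ :=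
  Polynomial.lsum fun k => (k.factorial : ℚ) • LinearMap.id

theorem factorialFunctional_monomial (k : ℕ) (c : ℚ) :
    factorialFunctional (Polynomial.monomial k c) = k.factorial * c := by
  simp [factorialFunctional, Polynomial.lsum_apply, Polynomial.sum_monomial_index]

/-- Integration by parts against `exp (-w)`. -/
theorem factorialFunctional_derivative (q : Polynomial ℚ) :
    factorialFunctional (Polynomial.derivative q) = factorialFunctional q - q.eval 0 := by
  induction q using Polynomial.induction_on' with
  | add p q hp hq => simp only [map_add, hp, hq, Polynomial.eval_add]; ring
  | monomial k c =>
    rw [Polynomial.derivative_monomial, factorialFunctional_monomial,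
      factorialFunctional_monomial]
    rcases k with _ | k
    · simp
    · simp [Nat.factorial_succ, Polynomial.eval_monomial]
      ring

theorem mem_paths_cons {s p : ℕ × ℕ × ℕ} {l : List (ℕ × ℕ × ℕ)} :
    s :: l ∈ paths p ↔ s ∈ steps ∧ (∀ t ∈ l, t ∈ steps) ∧ s + l.sum = p := by
  simp only [paths, Set.mem_ofPred_eq, List.forall_mem_cons, List.sum_cons, and_assoc]

/-- Sorting the paths to a cell by their first move. -/
theorem paths_eq (i j k : ℕ) : paths (i, j, k) =
    {l | l = [] ∧ i = 0 ∧ j = 0 ∧ k = 0} ∪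
    ((⋃ m ∈ Finset.range i, List.cons (i - m, 0, 0) '' paths (m, j, k)) ∪
    ((⋃ m ∈ Finset.range j, List.cons (0, j - m, 0) '' paths (i, m, k)) ∪
    (⋃ m ∈ Finset.range k, List.cons (0, 0, k - m) '' paths (i, j, m)))) := by
  ext l
  rcases l with _ | ⟨s, l⟩
  · simp only [paths, Set.mem_ofPred_eq, Set.mem_union, Set.mem_iUnion, Set.mem_image, reduceCtorEq,
      and_false, exists_false, or_false, List.not_mem_nil, false_imp_iff, implies_true, true_and,
      List.sum_nil, Prod.ext_iff, Prod.fst_zero, Prod.snd_zero, eq_comm (a := 0)]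
  · rw [mem_paths_cons]
    simp only [Set.mem_union, Set.mem_ofPred_eq, Set.mem_iUnion, Set.mem_image, Finset.mem_range,
      List.cons.injEq, reduceCtorEq, false_and, false_or, exists_prop]
    obtain ⟨x, y, z, hl⟩ : ∃ x y z, l.sum = (x, y, z) := ⟨_, _, _, rfl⟩
    rw [hl]
    constructor
    · rintro ⟨(⟨n, hn, rfl⟩ | ⟨n, hn, rfl⟩) | ⟨n, hn, rfl⟩, hst, heq⟩ <;>
        simp only [Prod.mk_add_mk, Prod.mk.injEq, zero_add] at heq <;>
        obtain ⟨h1, h2, h3⟩ := heq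
      · exact Or.inl ⟨x, by omega, l, ⟨hst, by simp [hl, h2, h3]⟩, by simp; omega, rfl⟩
      · exact Or.inr (Or.inl ⟨y, by omega, l, ⟨hst, by simp [hl, h1, h3]⟩, by simp; omega, rfl⟩)
      · exact Or.inr (Or.inr ⟨z, by omega, l, ⟨hst, by simp [hl, h1, h2]⟩, by simp; omega, rfl⟩)
    · rintro (⟨m, hm, l', ⟨hst, hs⟩, rfl, rfl⟩ | ⟨m, hm, l', ⟨hst, hs⟩, rfl, rfl⟩ |
        ⟨m, hm, l', ⟨hst, hs⟩, rfl, rfl⟩) <;>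
        rw [hl, Prod.mk.injEq, Prod.mk.injEq] at hs <;> obtain ⟨rfl, rfl, rfl⟩ := hs
      · exact ⟨Or.inl (Or.inl ⟨i - x, by omega, rfl⟩), hst, by simp; omega⟩
      · exact ⟨Or.inl (Or.inr ⟨j - y, by omega, rfl⟩), hst, by simp; omega⟩
      · exact ⟨Or.inr ⟨k - z, by omega, rfl⟩, hst, by simp; omega⟩

theorem ncard_biUnion_cons_image (n : ℕ) (s : ℕ → ℕ × ℕ × ℕ) (hs : Set.InjOn s (Finset.range n))
    (P : ℕ → Set (List (ℕ × ℕ × ℕ))) (hP : ∀ m, (P m).Finite) :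
    (⋃ m ∈ Finset.range n, List.cons (s m) '' P m).ncard =
      ∑ m ∈ Finset.range n, (P m).ncard := by
  classical
  have h1 : ∀ m, ((hP m).toFinset.image (List.cons (s m)) : Finset _) =
      List.cons (s m) '' P m := by simp
  have h2 : (⋃ m ∈ Finset.range n, List.cons (s m) '' P m) =
      ((Finset.range n).biUnion fun m => (hP m).toFinset.image (List.cons (s m)) : Finset _) := by
    simp
  rw [h2, Set.ncard_coe_finset, Finset.card_biUnion]
  · refine Finset.sum_congr rfl fun m _ => ?_
    rw [Finset.card_image_of_injective _ (List.cons_injective), Set.ncard_eq_toFinset_card _ (hP m)]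
  · intro m hm m' hm' hne
    rw [Function.onFun, Finset.disjoint_left]
    intro l hl hl'
    simp only [Finset.mem_image] at hl hl'
    obtain ⟨x, _, rfl⟩ := hl
    obtain ⟨y, _, hy⟩ := hl'
    exact hne (hs hm hm' (List.cons.inj hy).1.symm)

theorem numPaths_rec (i j k : ℕ) : numPaths i j k =
    (if i = 0 ∧ j = 0 ∧ k = 0 then 1 else 0) + (∑ m ∈ Finset.range i, numPaths m j k +
      (∑ m ∈ Finset.range j, numPaths i m k + ∑ m ∈ Finset.range k, numPaths i j m)) := by
  have hfin : ∀ (n : ℕ) (s : ℕ → ℕ × ℕ × ℕ) (c : ℕ → ℕ × ℕ × ℕ),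
      (⋃ m ∈ Finset.range n, List.cons (s m) '' paths (c m)).Finite := fun n s c =>
    (Finset.range n).finite_toSet.biUnion fun m _ => (paths_finite _).image _
  have h0 : {l : List (ℕ × ℕ × ℕ) | l = [] ∧ i = 0 ∧ j = 0 ∧ k = 0}.Finite :=
    (Set.finite_singleton []).subset fun l hl => hl.1
  rw [numPaths, paths_eq, Set.ncard_union_eq ?_ h0 ((hfin _ _ _).union ((hfin _ _ _).union
    (hfin _ _ _))), Set.ncard_union_eq ?_ (hfin _ _ _) ((hfin _ _ _).union (hfin _ _ _)),
    Set.ncard_union_eq ?_ (hfin _ _ _) (hfin _ _ _), ncard_biUnion_cons_image,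
    ncard_biUnion_cons_image, ncard_biUnion_cons_image]
  · congr 1
    split_ifs with h
    · simp [h]
    · simp [h]
  all_goals first | exact fun m => paths_finite _ | skip
  · intro m hm m' hm' h
    simp only [Finset.coe_range, Set.mem_Iio, Prod.mk.injEq] at hm hm' h
    omega
  · intro m hm m' hm' h
    simp only [Finset.coe_range, Set.mem_Iio, Prod.mk.injEq] at hm hm' h
    omega
  · intro m hm m' hm' h
    simp only [Finset.coe_range, Set.mem_Iio, Prod.mk.injEq] at hm hm' h
    omega
  all_goals
    rw [Set.disjoint_left]
    intro l h1 h2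
    simp only [Set.mem_union, Set.mem_iUnion, Set.mem_image, Finset.mem_range, exists_prop,
      Set.mem_ofPred_eq] at h1 h2
    grind

/-- The number of rook paths is a moment of a product of three Laguerre polynomials. -/
theorem numPaths_eq_factorialFunctional (i j k : ℕ) :
    (numPaths i j k : ℚ) = factorialFunctional (laguerre i * laguerre j * laguerre k) := by
  induction hN : i + j + k using Nat.strong_induction_on generalizing i j k with
  | _ N ih =>
  subst hN
  have h1 := factorialFunctional_derivative (laguerre i * laguerre j * laguerre k)
  rw [numPaths_rec]
  push_cast
  rw [Finset.sum_congr rfl fun m hm => ih (m + j + k) (by have := Finset.mem_range.1 hm; omega)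
      m j k rfl,
    Finset.sum_congr rfl fun m hm => ih (i + m + k) (by have := Finset.mem_range.1 hm; omega)
      i m k rfl,
    Finset.sum_congr rfl fun m hm => ih (i + j + m) (by have := Finset.mem_range.1 hm; omega)
      i j m rfl]
  simp only [Polynomial.derivative_mul, derivative_laguerre, add_mul, map_add, Finset.sum_mul,
    Finset.mul_sum, map_sum, Polynomial.eval_mul, eval_zero_laguerre] at h1
  have h2 : ((if i = 0 then 1 else 0) * (if j = 0 then 1 else 0) * (if k = 0 then 1 else 0) : ℚ) =
      if i = 0 ∧ j = 0 ∧ k = 0 then 1 else 0 := by split_ifs <;> simp_all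
  rw [h2] at h1
  -- `h1` is now the recursion by the first move, obtained by integrating by parts
  linarith

/-! ### The recurrence for the diagonal -/

section Certificate

variable {R : Type*} [CommRing R]

/-- The coefficient of `u ^ 3` in `certificate`. -/
def certificateCoeff₀ (N X : R) : R :=
  -N * (735 * N ^ 5 + 1645 * N ^ 4 - 435 * N ^ 3 - 1553 * N ^ 2 + 420 * N + 484) -
      3 * N * (147 * N ^ 7 + 595 * N ^ 6 + 29 * N ^ 5 - 1385 * N ^ 4 + 136 * N ^ 3 + 1334 * N ^ 2 - 192 * N - 232) * X -
      3 * N * (118 * N ^ 6 + 843 * N ^ 5 + 955 * N ^ 4 - 839 * N ^ 3 - 657 * N ^ 2 + 560 * N - 116) * X ^ 2 -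
      N * (N ^ 5 + 1519 * N ^ 4 + 2603 * N ^ 3 - 651 * N ^ 2 - 1068 * N + 1052) * X ^ 3 +
      18 * (N - 1) ^ 2 * (N - 2) * (N + 1) * (7 * N + 8) * X ^ 4 +
      24 * (N - 1) ^ 2 * (N - 2) * (N + 1) * X ^ 5 +
      2 * (N - 1) ^ 2 * (N - 2) * X ^ 6

/-- The coefficient of `u ^ 2 * t` in `certificate`. -/
def certificateCoeff₁ (N X : R) : R :=
  3 * N * (735 * N ^ 5 + 1645 * N ^ 4 - 435 * N ^ 3 - 1553 * N ^ 2 + 420 * N + 484) +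
      12 * N * (280 * N ^ 6 + 526 * N ^ 5 - 370 * N ^ 4 - 533 * N ^ 3 + 272 * N ^ 2 + 115 * N + 34) * X +
      3 * N * (1135 * N ^ 5 + 2799 * N ^ 4 + 913 * N ^ 3 - 879 * N ^ 2 - 572 * N - 804) * X ^ 2 +
      6 * (197 * N ^ 5 + 488 * N ^ 4 + 561 * N ^ 3 + 514 * N ^ 2 + 112 * N - 144) * X ^ 3 +
      6 * (N - 1) ^ 2 * (N - 2) * (11 * N + 12) * X ^ 4 +
      6 * (N - 1) ^ 2 * (N - 2) * X ^ 5

/-- The coefficient of `u * t ^ 2` in `certificate`. -/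
def certificateCoeff₂ (N X : R) : R :=
  -3 * N * (735 * N ^ 5 + 1645 * N ^ 4 - 435 * N ^ 3 - 1553 * N ^ 2 + 420 * N + 484) -
      3 * N * (1475 * N ^ 5 + 3925 * N ^ 4 - 703 * N ^ 3 - 5921 * N ^ 2 - 268 * N + 2788) * X -
      6 * (568 * N ^ 5 + 2007 * N ^ 4 + 1204 * N ^ 3 - 1485 * N ^ 2 - 1142 * N + 144) * X ^ 2 -
      12 * (67 * N ^ 4 + 302 * N ^ 3 + 359 * N ^ 2 + 124 * N + 12) * X ^ 3 +
      6 * (N - 1) ^ 2 * (N - 2) * X ^ 4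

/-- The coefficient of `t ^ 3` in `certificate`. -/
def certificateCoeff₃ (N X : R) : R :=
  N * (735 * N ^ 5 + 1645 * N ^ 4 - 435 * N ^ 3 - 1553 * N ^ 2 + 420 * N + 484) +
      6 * (435 * N ^ 5 + 967 * N ^ 4 - 475 * N ^ 3 - 1435 * N ^ 2 + 160 * N + 564) * X +
      6 * (255 * N ^ 4 + 784 * N ^ 3 + 395 * N ^ 2 - 562 * N - 440) * X ^ 2 +
      2 * (145 * N ^ 3 + 572 * N ^ 2 + 725 * N + 286) * X ^ 3

/-- The creative telescoping certificate, a cubic form in `u = laguerre N` and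
`t = X * derivative u`. The space of such forms over `ℚ(N)[X]` is stable under `X * derivative`, so
that the coefficients are found by solving a linear system. -/
def certificate (N X u t : R) : R :=
  certificateCoeff₀ N X * u ^ 3 + certificateCoeff₁ N X * u ^ 2 * t +
    certificateCoeff₂ N X * u * t ^ 2 + certificateCoeff₃ N X * t ^ 3

/-- The common denominator that has been cleared from the coefficients of the certificate. It
vanishes at `N = 1` and `N = 2`. -/
def certificateDenom (N : R) : R := (N - 1) ^ 2 * (N - 2) * (N + 1) ^ 2 * (N + 2)

/-- The operator of the recurrence for the numbers `m * a m`, applied to a sequence with the five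
terms `y₂, y₁, y₀, z₁, z₂` at `N + 2, N + 1, N, N - 1, N - 2`. -/
def recOperator (N y₂ y₁ y₀ z₁ z₂ : R) : R :=
  -2 * (N + 1) * (N + 2) * y₂ + (121 * N ^ 2 + 393 * N + 296) * y₁ +
    (475 * N ^ 2 - 612 * N - 295) * y₀ - 18 * (97 * N ^ 2 - 131 * N + 52) * z₁ +
    1152 * (N - 1) * (N - 2) * z₂

/-- Multiplied by the denominator, the cubes that enter the recurrence are polynomials in `N`, `X`,
`u` and `t`. -/
theorem certificateDenom_mul_recOperator (N X u t q₁ q₂ r₁ r₂ : R)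
    (h₁ : (N + 1) * q₁ = N * u + X * u + t)
    (h₂ : (N + 1) * ((N + 2) * q₂) =
      (N + 1) * (N * u + X * u + t) + X * (N * u + X * u + t) + (N + 1) * (X * u + t))
    (h₃ : (N - 1) * r₁ = N * u - t)
    (h₄ : (N - 1) * ((N - 2) * r₂) = (N - 1) * (N * u - t) - (N - 1) * t + X * (N * u - t)) :
    certificateDenom N * recOperator N ((N + 2) * q₂ ^ 3) ((N + 1) * q₁ ^ 3) (N * u ^ 3)
      ((N - 1) * r₁ ^ 3) ((N - 2) * r₂ ^ 3) =
    -2 * ((N - 1) ^ 2 * (N - 2)) * ((N + 1) * (N * u + X * u + t) + X * (N * u + X * u + t) +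
        (N + 1) * (X * u + t)) ^ 3 +
      (121 * N ^ 2 + 393 * N + 296) * ((N - 1) ^ 2 * (N - 2) * (N + 2)) *
        (N * u + X * u + t) ^ 3 +
      (475 * N ^ 2 - 612 * N - 295) * N * certificateDenom N * u ^ 3 -
      18 * (97 * N ^ 2 - 131 * N + 52) * ((N - 2) * (N + 1) ^ 2 * (N + 2)) * (N * u - t) ^ 3 +
      1152 * ((N + 1) ^ 2 * (N + 2)) *
        ((N - 1) * (N * u - t) - (N - 1) * t + X * (N * u - t)) ^ 3 := by
  rw [← h₂, ← h₄, ← h₁, ← h₃]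
  unfold certificateDenom recOperator
  ring

end Certificate

/-- The telescoping identity: up to the denominator, the recurrence operator applied to the cubes of
Laguerre polynomials has the form `C' - C`. -/
theorem derivative_certificate_sub (N u t q₁ q₂ r₁ r₂ : Polynomial ℚ)
    (hN : Polynomial.derivative N = 0)
    (hu : Polynomial.X * Polynomial.derivative u = t)
    (ht : Polynomial.X * Polynomial.derivative t = t + N * Polynomial.X * u - Polynomial.X * t)
    (h₁ : (N + 1) * q₁ = N * u + Polynomial.X * u + t)
    (h₂ : (N + 1) * ((N + 2) * q₂) = (N + 1) * (N * u + Polynomial.X * u + t) +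
      Polynomial.X * (N * u + Polynomial.X * u + t) + (N + 1) * (Polynomial.X * u + t))
    (h₃ : (N - 1) * r₁ = N * u - t)
    (h₄ : (N - 1) * ((N - 2) * r₂) =
      (N - 1) * (N * u - t) - (N - 1) * t + Polynomial.X * (N * u - t)) :
    Polynomial.derivative (certificate N Polynomial.X u t) - certificate N Polynomial.X u t =
      certificateDenom N * recOperator N ((N + 2) * q₂ ^ 3) ((N + 1) * q₁ ^ 3) (N * u ^ 3)
        ((N - 1) * r₁ ^ 3) ((N - 2) * r₂ ^ 3) := by
  rw [certificateDenom_mul_recOperator N Polynomial.X u t q₁ q₂ r₁ r₂ h₁ h₂ h₃ h₄]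
  refine mul_left_cancel₀ (Polynomial.X_ne_zero (R := ℚ)) ?_
  generalize hX : (Polynomial.X : Polynomial ℚ) = X at *
  have hX1 : Polynomial.derivative X = 1 := by rw [← hX, Polynomial.derivative_X]
  simp only [certificate, certificateCoeff₀, certificateCoeff₁, certificateCoeff₂,
    certificateCoeff₃, Polynomial.derivative_add, Polynomial.derivative_sub,
    Polynomial.derivative_neg, Polynomial.derivative_mul, Polynomial.derivative_pow,
    Polynomial.derivative_ofNat, Polynomial.derivative_one, hN, hX1, Nat.cast_ofNat,
    Nat.add_one_sub_one, pow_one, map_ofNat, mul_zero, zero_mul, add_zero, zero_add,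
    sub_zero, neg_zero, mul_one]
  -- the two factors are the partial derivatives of the certificate with respect to `u` and `t`
  linear_combination (norm := skip)
    (3 * certificateCoeff₀ N X * u ^ 2 + 2 * certificateCoeff₁ N X * u * t +
      certificateCoeff₂ N X * t ^ 2) * hu +
    (certificateCoeff₁ N X * u ^ 2 + 2 * certificateCoeff₂ N X * u * t +
      3 * certificateCoeff₃ N X * t ^ 2) * ht
  simp only [certificateCoeff₀, certificateCoeff₁, certificateCoeff₂, certificateCoeff₃,
    certificateDenom]
  ring

theorem factorialFunctional_C_mul (c : ℚ) (q : Polynomial ℚ) :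
    factorialFunctional (Polynomial.C c * q) = c * factorialFunctional q := by
  rw [← Polynomial.smul_eq_C_mul, map_smul, smul_eq_mul]

theorem a_eq_factorialFunctional (n : ℕ) : (a n : ℚ) = factorialFunctional (laguerre n ^ 3) := by
  rw [a, numPaths_eq_factorialFunctional]
  congr 1
  ring

/-- The recurrence for the diagonal. Integration by parts shows that the factorial functional vanishes
on `C' - C` when `C` has no constant term, and the certificate is such a `C`. The recurrence is
stated from `N = 3` on, where the denominator of the certificate does not vanish. -/
theorem recOperator_a (n : ℕ) : recOperator ((n : ℚ) + 3) (((n : ℚ) + 3 + 2) * a (n + 5))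
    (((n : ℚ) + 3 + 1) * a (n + 4)) (((n : ℚ) + 3) * a (n + 3)) (((n : ℚ) + 3 - 1) * a (n + 2))
    (((n : ℚ) + 3 - 2) * a (n + 1)) = 0 := by
  obtain ⟨ν, hν⟩ : ∃ ν : ℚ, ν = (n : ℚ) + 3 := ⟨_, rfl⟩
  have hN : (Polynomial.C ν : Polynomial ℚ) = (n : Polynomial ℚ) + 3 := by
    rw [hν, map_add, map_natCast, map_ofNat]
  have e1 := succ_mul_laguerre_succ (n + 3)
  have e2 := succ_mul_laguerre_succ (n + 4)
  have e3 := mul_laguerre_eq_sub (n + 2)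
  have e4 := mul_laguerre_eq_sub (n + 1)
  have d2 := derivative_laguerre_succ (n + 3)
  have d3 := derivative_laguerre_succ (n + 2)
  have o := laguerre_ode (n + 3)
  rw [d2] at e2
  rw [show n + 2 + 1 = n + 3 from rfl] at e3 d3
  rw [show n + 1 + 1 = n + 2 from rfl] at e4
  rw [show n + 3 + 1 = n + 4 from rfl] at e1
  rw [show n + 4 + 1 = n + 5 from rfl] at e2
  push_cast at e1 e2 e3 e4 o
  have key := derivative_certificate_sub (Polynomial.C ν) (laguerre (n + 3))
    (Polynomial.X * Polynomial.derivative (laguerre (n + 3))) (laguerre (n + 4)) (laguerre (n + 5))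
    (laguerre (n + 2)) (laguerre (n + 1)) (Polynomial.derivative_C) rfl
    (by
      rw [Polynomial.derivative_mul, Polynomial.derivative_X, hN]
      linear_combination Polynomial.X * o)
    (by rw [hN]; linear_combination e1)
    (by
      rw [hN]
      linear_combination ((n : Polynomial ℚ) + 4) * e2 +
        ((n : Polynomial ℚ) + 4 + Polynomial.X) * e1)
    (by rw [hN]; linear_combination e3)
    (by
      rw [hN]
      linear_combination ((n : Polynomial ℚ) + 2) * e4 +
        ((n : Polynomial ℚ) + 2 + Polynomial.X) * e3 +
          Polynomial.X * ((n : Polynomial ℚ) + 2) * d3)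
  have hE := congrArg factorialFunctional key
  rw [map_sub, factorialFunctional_derivative] at hE
  have h0 : (certificate (Polynomial.C ν) Polynomial.X (laguerre (n + 3))
      (Polynomial.X * Polynomial.derivative (laguerre (n + 3)))).eval 0 = 0 := by
    simp [certificate, eval_zero_laguerre]
  have hR : certificateDenom (Polynomial.C ν) * recOperator (Polynomial.C ν)
        ((Polynomial.C ν + 2) * laguerre (n + 5) ^ 3) ((Polynomial.C ν + 1) * laguerre (n + 4) ^ 3)
        (Polynomial.C ν * laguerre (n + 3) ^ 3) ((Polynomial.C ν - 1) * laguerre (n + 2) ^ 3)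
        ((Polynomial.C ν - 2) * laguerre (n + 1) ^ 3) =
      Polynomial.C (certificateDenom ν) *
        (Polynomial.C (-2 * (ν + 1) * (ν + 2) * (ν + 2)) * laguerre (n + 5) ^ 3 +
        Polynomial.C ((121 * ν ^ 2 + 393 * ν + 296) * (ν + 1)) * laguerre (n + 4) ^ 3 +
        Polynomial.C ((475 * ν ^ 2 - 612 * ν - 295) * ν) * laguerre (n + 3) ^ 3 +
        Polynomial.C (-18 * (97 * ν ^ 2 - 131 * ν + 52) * (ν - 1)) * laguerre (n + 2) ^ 3 +
        Polynomial.C (1152 * (ν - 1) * (ν - 2) * (ν - 2)) * laguerre (n + 1) ^ 3) := by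
    simp only [certificateDenom, recOperator, map_mul, map_add, map_sub, map_neg, map_pow,
      Polynomial.C_ofNat, Polynomial.C_1]
    ring
  have hden : certificateDenom ν ≠ 0 := by
    have h1 : ν - 1 = n + 2 := by rw [hν]; ring
    have h2 : ν - 2 = n + 1 := by rw [hν]; ring
    rw [certificateDenom, h1, h2, hν]
    positivity
  rw [h0, hR, factorialFunctional_C_mul] at hE
  simp only [map_add, factorialFunctional_C_mul, ← a_eq_factorialFunctional] at hE
  rw [← hν]
  unfold recOperator
  refine mul_left_cancel₀ hden ?_
  linear_combination -hE

theorem factorialFunctional_C_mul_X_pow (c : ℚ) (k : ℕ) :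
    factorialFunctional (Polynomial.C c * Polynomial.X ^ k) = k.factorial * c := by
  rw [Polynomial.C_mul_X_pow_eq_monomial, factorialFunctional_monomial]

theorem a_eq_of_expansion {n : ℕ} {c : ℚ} (hc : c ≠ 0) {q : Polynomial ℚ}
    (hq : Polynomial.C c * laguerre n = q) :
    (a n : ℚ) = factorialFunctional (q ^ 3) / c ^ 3 := by
  rw [← hq, mul_pow, ← Polynomial.C_pow, factorialFunctional_C_mul, a_eq_factorialFunctional]
  field_simp

/-- The first values of the diagonal, which the cases `N = 0, 1, 2` of the recurrence involve. -/
theorem a_one_two_three_four :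
    (a 1 : ℚ) = 6 ∧ (a 2 : ℚ) = 222 ∧ (a 3 : ℚ) = 9918 ∧ (a 4 : ℚ) = 486924 := by
  have l1 : laguerre 1 = Polynomial.X := by simp [laguerre]
  have d1 : Polynomial.derivative (laguerre 1) = 1 := by rw [l1, Polynomial.derivative_X]
  have e2 := succ_mul_laguerre_succ 1
  have e3 := succ_mul_laguerre_succ 2
  have e4 := succ_mul_laguerre_succ 3
  have d2 := derivative_laguerre_succ 1
  have d3 := derivative_laguerre_succ 2
  simp only [Nat.reduceAdd] at e2 e3 e4 d2 d3
  rw [d3, d2] at e4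
  rw [d2] at e3
  rw [d1, l1] at e2 e3 e4
  push_cast at e2 e3 e4
  have q2 : Polynomial.C 2 * laguerre 2 = 2 * Polynomial.X + Polynomial.X ^ 2 := by
    rw [Polynomial.C_ofNat]
    linear_combination e2
  have q3 : Polynomial.C 6 * laguerre 3 =
      6 * Polynomial.X + 6 * Polynomial.X ^ 2 + Polynomial.X ^ 3 := by
    rw [Polynomial.C_ofNat]
    linear_combination 2 * e3 + (2 + Polynomial.X) * e2
  have q4 : Polynomial.C 24 * laguerre 4 = 24 * Polynomial.X + 36 * Polynomial.X ^ 2 +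
      12 * Polynomial.X ^ 3 + Polynomial.X ^ 4 := by
    rw [Polynomial.C_ofNat]
    linear_combination 6 * e4 + (6 + 2 * Polynomial.X) * e3 +
      (6 + 8 * Polynomial.X + Polynomial.X ^ 2) * e2
  refine ⟨?_, ?_, ?_, ?_⟩
  · rw [a_eq_factorialFunctional, l1, ← one_mul (Polynomial.X ^ 3), ← Polynomial.C_1,
      factorialFunctional_C_mul_X_pow]
    norm_num [Nat.factorial]
  · rw [a_eq_of_expansion two_ne_zero q2, show (2 * Polynomial.X + Polynomial.X ^ 2) ^ 3 =
        (Polynomial.C 8 * Polynomial.X ^ 3 + Polynomial.C 12 * Polynomial.X ^ 4 +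
        Polynomial.C 6 * Polynomial.X ^ 5 + Polynomial.C 1 * Polynomial.X ^ 6 : Polynomial ℚ) by
      simp only [Polynomial.C_ofNat, Polynomial.C_1]
      ring]
    simp only [map_add, factorialFunctional_C_mul_X_pow]
    norm_num [Nat.factorial]
  · rw [a_eq_of_expansion (by norm_num) q3,
      show (6 * Polynomial.X + 6 * Polynomial.X ^ 2 + Polynomial.X ^ 3) ^ 3 =
        (Polynomial.C 216 * Polynomial.X ^ 3 + Polynomial.C 648 * Polynomial.X ^ 4 +
        Polynomial.C 756 * Polynomial.X ^ 5 + Polynomial.C 432 * Polynomial.X ^ 6 +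
        Polynomial.C 126 * Polynomial.X ^ 7 + Polynomial.C 18 * Polynomial.X ^ 8 +
        Polynomial.C 1 * Polynomial.X ^ 9 : Polynomial ℚ) by
      simp only [Polynomial.C_ofNat, Polynomial.C_1]
      ring]
    simp only [map_add, factorialFunctional_C_mul_X_pow]
    norm_num [Nat.factorial]
  · rw [a_eq_of_expansion (by norm_num) q4, show (24 * Polynomial.X + 36 * Polynomial.X ^ 2 +
        12 * Polynomial.X ^ 3 + Polynomial.X ^ 4) ^ 3 =
        (Polynomial.C 13824 * Polynomial.X ^ 3 + Polynomial.C 62208 * Polynomial.X ^ 4 +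
        Polynomial.C 114048 * Polynomial.X ^ 5 + Polynomial.C 110592 * Polynomial.X ^ 6 +
        Polynomial.C 62208 * Polynomial.X ^ 7 + Polynomial.C 21168 * Polynomial.X ^ 8 +
        Polynomial.C 4392 * Polynomial.X ^ 9 + Polynomial.C 540 * Polynomial.X ^ 10 +
        Polynomial.C 36 * Polynomial.X ^ 11 + Polynomial.C 1 * Polynomial.X ^ 12 :
          Polynomial ℚ) by
      simp only [Polynomial.C_ofNat, Polynomial.C_1]
      ring]
    simp only [map_add, factorialFunctional_C_mul_X_pow]
    norm_num [Nat.factorial]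

/-! ### The differential equation -/

open PowerSeries in
/-- The second order differential operator that annihilates `∂_x G`, multiplied by `X` so that it is
written in terms of `X ^ 2 * y''`, `X * y'` and `y`. -/
noncomputable def rookOperator (y : PowerSeries ℚ) : PowerSeries ℚ :=
  (-2 + 121 * X + 475 * X ^ 2 - 1746 * X ^ 3 + 1152 * X ^ 4) * (X ^ 2 * d⁄dX ℚ (d⁄dX ℚ y)) +
    (-4 + 514 * X + 813 * X ^ 2 - 6372 * X ^ 3 + 4608 * X ^ 4) * (X * d⁄dX ℚ y) +
    (296 * X - 432 * X ^ 2 - 3204 * X ^ 3 + 2304 * X ^ 4) * y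

section

open PowerSeries

theorem coeff_X_mul_derivative (y : ℚ⟦X⟧) (n : ℕ) :
    coeff n (X * d⁄dX ℚ y) = n * coeff n y := by
  rcases n with _ | n
  · simp
  · rw [coeff_succ_X_mul, coeff_derivative]
    push_cast
    ring

theorem coeff_X_sq_mul_derivative_derivative (y : ℚ⟦X⟧) (n : ℕ) :
    coeff n (X ^ 2 * d⁄dX ℚ (d⁄dX ℚ y)) = n * (n - 1) * coeff n y := by
  rcases n with _ | _ | n
  · simp
  · simp [coeff_X_pow_mul']
  · rw [show n + 1 + 1 = n + 2 from rfl, coeff_X_pow_mul, coeff_derivative, coeff_derivative]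
    push_cast
    ring

theorem coeff_rookOperator (y : ℚ⟦X⟧) (n : ℕ) : coeff n (rookOperator y) =
    -2 * n * (n + 1) * coeff n y +
    (if 1 ≤ n then (121 * n ^ 2 + 151 * n + 24) * coeff (n - 1) y else 0) +
    (if 2 ≤ n then (475 * n ^ 2 - 1562 * n + 792) * coeff (n - 2) y else 0) +
    (if 3 ≤ n then -18 * (97 * n ^ 2 - 325 * n + 280) * coeff (n - 3) y else 0) +
    (if 4 ≤ n then 1152 * (n - 2) * (n - 3) * coeff (n - 4) y else 0) := by
  have hC : rookOperator y =
      (C (-2) * (X ^ 0 * (X ^ 2 * d⁄dX ℚ (d⁄dX ℚ y))) + C (-4) * (X ^ 0 * (X * d⁄dX ℚ y))) +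
      (C 121 * (X ^ 1 * (X ^ 2 * d⁄dX ℚ (d⁄dX ℚ y))) + C 514 * (X ^ 1 * (X * d⁄dX ℚ y)) +
        C 296 * (X ^ 1 * y)) +
      (C 475 * (X ^ 2 * (X ^ 2 * d⁄dX ℚ (d⁄dX ℚ y))) + C 813 * (X ^ 2 * (X * d⁄dX ℚ y)) +
        C (-432) * (X ^ 2 * y)) +
      (C (-1746) * (X ^ 3 * (X ^ 2 * d⁄dX ℚ (d⁄dX ℚ y))) + C (-6372) * (X ^ 3 * (X * d⁄dX ℚ y)) +
        C (-3204) * (X ^ 3 * y)) +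
      (C 1152 * (X ^ 4 * (X ^ 2 * d⁄dX ℚ (d⁄dX ℚ y))) + C 4608 * (X ^ 4 * (X * d⁄dX ℚ y)) +
        C 2304 * (X ^ 4 * y)) := by
    simp only [rookOperator, map_neg, map_ofNat]
    ring
  rw [hC]
  simp only [map_add, coeff_C_mul, coeff_X_pow_mul' _ _ n, coeff_X_mul_derivative,
    coeff_X_sq_mul_derivative_derivative]
  congr 1
  · congr 1
    · congr 1
      · congr 1
        · simp only [zero_le, if_true, Nat.sub_zero]
          ring
        · split_ifs with h
          · push_cast [Nat.cast_sub h]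
            ring
          · ring
      · split_ifs with h
        · push_cast [Nat.cast_sub h]
          ring
        · ring
    · split_ifs with h
      · push_cast [Nat.cast_sub h]
        ring
      · ring
  · split_ifs with h
    · push_cast [Nat.cast_sub h]
      ring
    · ring

/-- The exponents of the operator at `0` are `0` and `-1`, so a power series solution is determined
by its constant coefficient. -/
theorem eq_zero_of_rookOperator_eq_zero {y : ℚ⟦X⟧} (hy : rookOperator y = 0)
    (h0 : coeff 0 y = 0) : y = 0 := by
  ext n
  induction n using Nat.strong_induction_on with
  | _ n ih =>
  rcases Nat.eq_zero_or_pos n with rfl | hn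
  · simpa using h0
  have h1 := coeff_rookOperator y n
  have hz : ∀ k, 0 < k → coeff (n - k) y = 0 := fun k hk => by
    rw [ih _ (Nat.sub_lt hn hk), map_zero]
  rw [hy, hz 1 one_pos, hz 2 two_pos, hz 3 three_pos, hz 4 four_pos] at h1
  simp only [mul_zero, ite_self, add_zero, map_zero] at h1
  have h2 : (-2 * (n : ℚ) * (n + 1)) ≠ 0 := by
    have : (n : ℚ) ≠ 0 := by exact_mod_cast hn.ne'
    have : (n : ℚ) + 1 ≠ 0 := by positivity
    simp_all
  rw [map_zero]
  exact (mul_eq_zero.1 h1.symm).resolve_left h2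

theorem rookOperator_sub (y z : ℚ⟦X⟧) :
    rookOperator (y - z) = rookOperator y - rookOperator z := by
  simp only [rookOperator, map_sub]
  ring

theorem eq_of_rookOperator_eq_zero {y z : ℚ⟦X⟧} (hy : rookOperator y = 0)
    (hz : rookOperator z = 0) (h0 : coeff 0 y = coeff 0 z) : y = z :=
  sub_eq_zero.1 <| eq_zero_of_rookOperator_eq_zero (by rw [rookOperator_sub, hy, hz, sub_zero])
    (by rw [map_sub, h0, sub_self])

theorem coeff_derivative_G (n : ℕ) : coeff n (d⁄dX ℚ G) = (n + 1) * a (n + 1) := by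
  rw [coeff_derivative, G, coeff_mk]
  ring

theorem rookOperator_derivative_G : rookOperator (d⁄dX ℚ G) = 0 := by
  obtain ⟨a1, a2, a3, a4⟩ := a_one_two_three_four
  ext n
  rw [coeff_rookOperator, map_zero]
  simp only [coeff_derivative_G]
  rcases n with _ | _ | _ | _ | n
  · simp
  · norm_num [a1, a2]
  · norm_num [a1, a2, a3]
  · norm_num [a1, a2, a3, a4]
  · have h1 := recOperator_a n
    unfold recOperator at h1
    simp only [show 1 ≤ n + 1 + 1 + 1 + 1 by omega, show 2 ≤ n + 1 + 1 + 1 + 1 by omega,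
      show 3 ≤ n + 1 + 1 + 1 + 1 by omega, show 4 ≤ n + 1 + 1 + 1 + 1 by omega, if_true,
      show n + 1 + 1 + 1 + 1 - 1 = n + 3 by omega, show n + 1 + 1 + 1 + 1 - 2 = n + 2 by omega,
      show n + 1 + 1 + 1 + 1 - 3 = n + 1 by omega, show n + 1 + 1 + 1 + 1 - 4 = n by omega,
      show n + 1 + 1 + 1 + 1 = n + 4 by omega, add_assoc, Nat.reduceAdd] at h1 ⊢
    push_cast
    linear_combination h1

end

/-! ### The hypergeometric closed form -/

section

open PowerSeries

/-- The geometric series `1 / (1 - r X)`. -/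
noncomputable def geomSeries (r : ℚ) : ℚ⟦X⟧ := PowerSeries.mk fun n => r ^ n

theorem one_sub_mul_geomSeries (r : ℚ) : (1 - C r * X) * geomSeries r = 1 := by
  ext n
  rw [sub_mul, one_mul, mul_assoc, map_sub, coeff_C_mul, geomSeries, coeff_mk]
  rcases n with _ | n
  · simp
  · rw [coeff_succ_X_mul, coeff_mk, coeff_one, if_neg n.succ_ne_zero]
    ring

theorem derivative_geomSeries (r : ℚ) :
    d⁄dX ℚ (geomSeries r) = C r * geomSeries r ^ 2 := by
  have h1 := one_sub_mul_geomSeries r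
  have h2 := congrArg (d⁄dX ℚ) h1
  simp only [Derivation.leibniz, map_sub, Derivation.map_one_eq_zero, derivative_C, derivative_X,
    smul_eq_mul] at h2
  linear_combination geomSeries r * h2 - (d⁄dX ℚ (geomSeries r)) * h1

/-- The series `₂F₁(1/3, 2/3; 2; X)`. -/
noncomputable def hypSeries : ℚ⟦X⟧ :=
  PowerSeries.mk (ordinaryHypergeometricCoefficient (1 / 3 : ℚ) (2 / 3) 2)

theorem coeff_hypSeries_succ (n : ℕ) : ((n : ℚ) + 1) * (n + 2) * coeff (n + 1) hypSeries =
    (n + 1 / 3) * (n + 2 / 3) * coeff n hypSeries := by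
  have h2 : (ascPochhammer ℚ n).eval 2 ≠ 0 := (ascPochhammer_pos n (2 : ℚ) two_pos).ne'
  have h3 : (n.factorial : ℚ) ≠ 0 := by exact_mod_cast n.factorial_ne_zero
  simp only [hypSeries, coeff_mk, ordinaryHypergeometricCoefficient, ascPochhammer_succ_eval,
    Nat.factorial_succ]
  push_cast
  field_simp
  ring

theorem hypSeries_ode : X * (1 - X) * d⁄dX ℚ (d⁄dX ℚ hypSeries) +
    2 * (1 - X) * d⁄dX ℚ hypSeries - C (2 / 9) * hypSeries = 0 := by
  -- after multiplication by `X` all terms have coefficients without truncated indices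
  have h : X * (X * (1 - X) * d⁄dX ℚ (d⁄dX ℚ hypSeries) +
      2 * (1 - X) * d⁄dX ℚ hypSeries - C (2 / 9) * hypSeries) = 0 := by
    rw [show X * (X * (1 - X) * d⁄dX ℚ (d⁄dX ℚ hypSeries) +
      2 * (1 - X) * d⁄dX ℚ hypSeries - C (2 / 9) * hypSeries) =
      X ^ 2 * d⁄dX ℚ (d⁄dX ℚ hypSeries) - X * (X ^ 2 * d⁄dX ℚ (d⁄dX ℚ hypSeries)) +
      (C 2 * (X * d⁄dX ℚ hypSeries) - C 2 * (X * (X * d⁄dX ℚ hypSeries))) -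
      C (2 / 9) * (X * hypSeries) by rw [map_ofNat]; ring]
    ext n
    rcases n with _ | n
    · simp
    · simp only [map_sub, map_add, coeff_C_mul, coeff_succ_X_mul, coeff_X_mul_derivative,
        coeff_X_sq_mul_derivative_derivative, coeff_derivative, map_zero]
      push_cast
      linear_combination coeff_hypSeries_succ n
  exact (mul_eq_zero.1 h).resolve_left X_ne_zero

/-- The series `27 x (2 - 3 x) / (1 - 4 x) ^ 3`, written as `27 x c ^ 2 (2 + 5 x c)` with
`c = 1 / (1 - 4 x)` so that its coefficients are visibly nonnegative. -/
noncomputable def argSeries : ℚ⟦X⟧ :=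
  C 27 * X * geomSeries 4 ^ 2 * (C 2 + C 5 * X * geomSeries 4)

/-- `6 ₂F₁(1/3, 2/3; 2; 27 x (2 - 3 x) / (1 - 4 x) ^ 3) / (1 - 4 x)`, the closed form of
`(1 - 64 x) G'(x)`. -/
noncomputable def numeratorSeries : ℚ⟦X⟧ := C 6 * hypSeries.subst argSeries * geomSeries 4

theorem constantCoeff_argSeries : constantCoeff argSeries = 0 := by
  simp [argSeries]

theorem hasSubst_argSeries : HasSubst argSeries :=
  HasSubst.of_constantCoeff_zero' constantCoeff_argSeries

theorem argSeries_eq : argSeries = 27 * X * (2 - 3 * X) * geomSeries 4 ^ 3 := by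
  have h := one_sub_mul_geomSeries 4
  simp only [argSeries, map_ofNat] at h ⊢
  linear_combination (-54) * X * geomSeries 4 ^ 2 * h

theorem derivative_argSeries :
    d⁄dX ℚ argSeries = 54 * (1 - X) * (1 + 6 * X) * geomSeries 4 ^ 4 := by
  have h := one_sub_mul_geomSeries 4
  rw [map_ofNat] at h
  have h27 : d⁄dX ℚ (27 : ℚ⟦X⟧) = 0 := by rw [← map_ofNat (C (R := ℚ)), derivative_C]
  have h2 : d⁄dX ℚ (2 : ℚ⟦X⟧) = 0 := by rw [← map_ofNat (C (R := ℚ)), derivative_C]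
  have h3 : d⁄dX ℚ (3 : ℚ⟦X⟧) = 0 := by rw [← map_ofNat (C (R := ℚ)), derivative_C]
  rw [argSeries_eq]
  simp only [Derivation.leibniz, Derivation.leibniz_pow, map_sub, h27, h2, h3, derivative_X,
    derivative_geomSeries, smul_eq_mul, nsmul_eq_mul, map_ofNat]
  push_cast
  linear_combination (-27) * (2 - 6 * X) * geomSeries 4 ^ 3 * h

/-- The hypergeometric equation, transported along the substitution. -/
theorem subst_ode : argSeries * (1 - argSeries) * (d⁄dX ℚ (d⁄dX ℚ hypSeries)).subst argSeries +
    2 * (1 - argSeries) * (d⁄dX ℚ hypSeries).subst argSeries -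
      C (2 / 9) * hypSeries.subst argSeries = 0 := by
  have h := congrArg (substAlgHom hasSubst_argSeries) hypSeries_ode
  simp only [← smul_eq_C_mul, map_add, map_sub, map_mul, map_one, map_ofNat, map_smul, map_zero,
    substAlgHom_X] at h ⊢
  simpa only [coe_substAlgHom] using h

/-- The closed form satisfies the differential equation of `∂_x G`. -/
theorem rookOperator_closedForm : rookOperator (numeratorSeries * geomSeries 64) = 0 := by
  have hc := one_sub_mul_geomSeries 4
  have hg := one_sub_mul_geomSeries 64
  have hφ := argSeries_eq
  have hφ' := derivative_argSeries
  have hO := subst_ode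
  have hS : d⁄dX ℚ (hypSeries.subst argSeries) =
    (d⁄dX ℚ hypSeries).subst argSeries * d⁄dX ℚ argSeries := derivative_subst hasSubst_argSeries
  have hS1 : d⁄dX ℚ ((d⁄dX ℚ hypSeries).subst argSeries) =
    (d⁄dX ℚ (d⁄dX ℚ hypSeries)).subst argSeries * d⁄dX ℚ argSeries :=
    derivative_subst hasSubst_argSeries
  obtain ⟨K, hK⟩ : ∃ K, K = numeratorSeries * geomSeries 64 := ⟨_, rfl⟩
  rw [← hK]
  rw [numeratorSeries] at hK
  obtain ⟨S, hS0⟩ : ∃ S : ℚ⟦X⟧, S = hypSeries.subst argSeries := ⟨_, rfl⟩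
  obtain ⟨S1, hS10⟩ : ∃ S : ℚ⟦X⟧, S = (d⁄dX ℚ hypSeries).subst argSeries := ⟨_, rfl⟩
  obtain ⟨S2, hS20⟩ : ∃ S : ℚ⟦X⟧, S = (d⁄dX ℚ (d⁄dX ℚ hypSeries)).subst argSeries := ⟨_, rfl⟩
  rw [← hS0, ← hS10] at hS
  rw [← hS10, ← hS20] at hS1
  rw [← hS0, ← hS10, ← hS20] at hO
  rw [← hS0] at hK
  clear hS0 hS10 hS20
  generalize argSeries = φ at *
  generalize geomSeries 4 = c at *
  generalize geomSeries 64 = g at *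
  have hnum : ∀ n : ℕ, d⁄dX ℚ (n : ℚ⟦X⟧) = 0 := fun n => by
    rw [← map_natCast (C (R := ℚ)), derivative_C]
  have hn4 := hnum 4
  have hn6 := hnum 6
  have hn64 := hnum 64
  have hn54 := hnum 54
  push_cast at hn4 hn6 hn64 hn54
  simp only [map_ofNat] at hc hg hK
  have hC29 : (C (2 / 9) : ℚ⟦X⟧) * 9 = 2 := by
    rw [← map_ofNat (C (R := ℚ)) 9, ← map_mul]
    norm_num [map_ofNat]
  have hA : (1 - 4 * X) ^ 3 * φ = 27 * X * (2 - 3 * X) := by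
    have h3 : ((1 - 4 * X) * c) ^ 3 = 1 := by rw [hc, one_pow]
    rw [hφ]
    linear_combination 27 * X * (2 - 3 * X) * h3
  have hB : (1 - 4 * X) ^ 4 * d⁄dX ℚ φ = 54 * (1 - X) * (1 + 6 * X) := by
    have h4 : ((1 - 4 * X) * c) ^ 4 = 1 := by rw [hc, one_pow]
    rw [hφ']
    linear_combination 54 * (1 - X) * (1 + 6 * X) * h4
  -- `K` and its first two derivatives in terms of `S, S1, S2`, cleared of denominators
  have e0 : (1 - 4 * X) * (1 - 64 * X) * K = 6 * S := by
    rw [hK]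
    linear_combination 6 * S * ((1 - 64 * X) * g * hc + hg)
  have e1' := congrArg (d⁄dX ℚ) e0
  simp only [Derivation.leibniz, map_sub, hn4, hn6, hn64, Derivation.map_one_eq_zero,
    derivative_X, smul_eq_mul, hS] at e1'
  have e1 : (1 - 4 * X) ^ 4 * ((-68 + 512 * X) * K + (1 - 4 * X) * (1 - 64 * X) * d⁄dX ℚ K) =
      6 * (54 * (1 - X) * (1 + 6 * X)) * S1 := by
    rw [← hB]
    linear_combination (1 - 4 * X) ^ 4 * e1'
  have e2' := congrArg (d⁄dX ℚ) e1'
  have e2'' := congrArg (d⁄dX ℚ) hB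
  simp only [Derivation.leibniz, Derivation.leibniz_pow, map_sub, map_add, hn4, hn6, hn64, hn54,
    Derivation.map_one_eq_zero, derivative_X, smul_eq_mul, nsmul_eq_mul, hS1, map_zero] at e2' e2''
  push_cast at e2' e2''
  have e2 : (1 - 4 * X) ^ 8 * (512 * K + 2 * (-68 + 512 * X) * d⁄dX ℚ K +
      (1 - 4 * X) * (1 - 64 * X) * d⁄dX ℚ (d⁄dX ℚ K)) = 6 * S1 * (1 - 4 * X) ^ 4 *
        (54 * (5 - 12 * X)) + 16 * (6 * S1 * (1 - 4 * X) ^ 3 * (54 * (1 - X) * (1 + 6 * X))) +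
      6 * (54 * (1 - X) * (1 + 6 * X)) ^ 2 * S2 := by
    linear_combination (1 - 4 * X) ^ 8 * e2' + 6 * S1 * (1 - 4 * X) ^ 4 * e2'' +
      96 * S1 * (1 - 4 * X) ^ 3 * hB +
      6 * S2 * ((1 - 4 * X) ^ 4 * d⁄dX ℚ φ + 54 * (1 - X) * (1 + 6 * X)) * hB
  have hO' : 27 * X * (2 - 3 * X) * (1 - 64 * X) * (1 - X) ^ 2 * S2 +
      2 * (1 - 4 * X) ^ 3 * (1 - 64 * X) * (1 - X) ^ 2 * S1 =
      C (2 / 9) * (1 - 4 * X) ^ 6 * S := by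
    linear_combination (1 - 4 * X) ^ 6 * hO - S2 * ((1 - 4 * X) ^ 3 - (1 - 4 * X) ^ 3 * φ -
      27 * X * (2 - 3 * X)) * hA + 2 * (1 - 4 * X) ^ 3 * S1 * hA
  -- eliminating `S, S1, S2` leaves a nonzero multiple of the operator
  have key : (13122 * (1 - 64 * X) * (1 - X) ^ 2 * (1 - 4 * X) ^ 9) * rookOperator K = 0 := by
    rw [rookOperator]
    linear_combination (-X) * (9 * (27 * X * (2 - 3 * X) * (1 - 64 * X) * (1 - X) ^ 2 *
        (54 * (1 - X) * (1 + 6 * X)) * e2 -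
      27 * X * (2 - 3 * X) * (1 - 64 * X) * (1 - X) ^ 2 * ((1 - 4 * X) ^ 4 * (54 * (5 - 12 * X)) +
        16 * (1 - 4 * X) ^ 3 * (54 * (1 - X) * (1 + 6 * X))) * e1 +
      2 * (1 - 4 * X) ^ 3 * (1 - 64 * X) * (1 - X) ^ 2 * (54 * (1 - X) * (1 + 6 * X)) ^ 2 * e1 -
      C (2 / 9) * (1 - 4 * X) ^ 6 * (54 * (1 - X) * (1 + 6 * X)) ^ 3 * e0 +
      6 * (54 * (1 - X) * (1 + 6 * X)) ^ 3 * hO') +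
      (1 - 4 * X) ^ 6 * (54 * (1 - X) * (1 + 6 * X)) ^ 3 * (1 - 4 * X) * (1 - 64 * X) * K * hC29)
  refine (mul_eq_zero.1 key).resolve_left fun h0 => ?_
  have h1 := congrArg constantCoeff h0
  simp [map_ofNat] at h1

/-- The closed form of `∂_x G` as a hypergeometric series. -/
theorem derivative_G_eq : d⁄dX ℚ G = numeratorSeries * geomSeries 64 := by
  refine eq_of_rookOperator_eq_zero rookOperator_derivative_G rookOperator_closedForm ?_
  have h1 : constantCoeff (hypSeries.subst argSeries : ℚ⟦X⟧) = 1 := by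
    rw [← coeff_zero_eq_constantCoeff_apply, coeff_subst' hasSubst_argSeries,
      finsum_eq_single _ 0 fun k hk => by simp [constantCoeff_argSeries, hk]]
    simp [hypSeries, ordinaryHypergeometricCoefficient]
  rw [coeff_derivative_G, a_one_two_three_four.1, coeff_zero_eq_constantCoeff_apply,
    numeratorSeries, map_mul, map_mul, map_mul, h1]
  simp [geomSeries, ← coeff_zero_eq_constantCoeff_apply]

end

/-! ### Gauss's value of the hypergeometric series -/

section

open PowerSeries

/-- The `n`-th partial product that turns out to be a partial sum of `hypSeries` at `1`. -/
noncomputable def partialProduct (n : ℕ) : ℝ :=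
  3 / 2 * ((n + 2 / 3) / (n + 1)) *
    ∏ j ∈ Finset.range n, (1 - (1 / 3 : ℝ) ^ 2 / ((j : ℝ) + 1) ^ 2)

theorem partialProduct_succ (n : ℕ) : ((n : ℝ) + 1) * (n + 2) * partialProduct (n + 1) =
    (n + 4 / 3) * (n + 5 / 3) * partialProduct n := by
  have h1 : (n : ℝ) + 1 ≠ 0 := by positivity
  have h2 : (n : ℝ) + 1 + 1 ≠ 0 := by positivity
  rw [partialProduct, partialProduct, Finset.prod_range_succ]
  push_cast
  field_simp
  ring

theorem coeff_hypSeries_eq (n : ℕ) : ((n : ℝ) + 1 / 3) * (n + 2 / 3) * (coeff n hypSeries : ℚ) =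
    2 / 9 * partialProduct n := by
  induction n with
  | zero => norm_num [hypSeries, partialProduct, ordinaryHypergeometricCoefficient]
  | succ n ih =>
    have h1 : ((n : ℝ) + 1) * (n + 2) ≠ 0 := by positivity
    have h2 := partialProduct_succ n
    have h3 := congrArg (Rat.cast : ℚ → ℝ) (coeff_hypSeries_succ n)
    push_cast at h3
    refine mul_left_cancel₀ h1 ?_
    push_cast
    linear_combination ((n : ℝ) + 1 + 1 / 3) * (n + 1 + 2 / 3) * (h3 + ih) - 2 / 9 * h2

theorem sum_coeff_hypSeries (n : ℕ) :
    ∑ k ∈ Finset.range (n + 1), ((coeff k hypSeries : ℚ) : ℝ) = partialProduct n := by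
  induction n with
  | zero => norm_num [hypSeries, partialProduct, ordinaryHypergeometricCoefficient]
  | succ n ih =>
    have h1 : ((n : ℝ) + 1) * (n + 2) ≠ 0 := by positivity
    have h2 := partialProduct_succ n
    have h3 := congrArg (Rat.cast : ℚ → ℝ) (coeff_hypSeries_succ n)
    push_cast at h3
    have h4 := coeff_hypSeries_eq n
    rw [Finset.sum_range_succ, ih]
    refine mul_left_cancel₀ h1 ?_
    linear_combination h3 + h4 - h2

theorem tendsto_partialProduct : Tendsto partialProduct atTop (𝓝 (9 * √3 / (4 * π))) := by
  have h1 := (Real.tendsto_euler_sin_prod (1 / 3)).const_mul (3 / π)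
  have h2 : Tendsto (fun n : ℕ => ((n : ℝ) + 2 / 3) / (n + 1)) atTop (𝓝 1) := by
    have h3 := (tendsto_one_div_add_atTop_nhds_zero_nat (𝕜 := ℝ)).const_mul (1 / 3)
    have h4 := h3.const_sub 1
    rw [mul_zero, sub_zero] at h4
    refine h4.congr fun n => ?_
    have : (n : ℝ) + 1 ≠ 0 := by positivity
    field_simp
    ring
  have h5 := (h2.const_mul (3 / 2)).mul h1
  rw [show π * (1 / 3) = π / 3 by ring, Real.sin_pi_div_three] at h5
  have hπ := Real.pi_ne_zero
  convert h5 using 1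
  · ext n
    rw [partialProduct]
    field_simp
  · congr 1
    field_simp
    ring

theorem coeff_hypSeries_nonneg (n : ℕ) : 0 ≤ coeff n hypSeries := by
  rw [hypSeries, coeff_mk]
  have h1 := (ascPochhammer_pos n (1 / 3 : ℚ) (by norm_num)).le
  have h2 := (ascPochhammer_pos n (2 / 3 : ℚ) (by norm_num)).le
  have h3 := (ascPochhammer_pos n (2 : ℚ) (by norm_num)).le
  positivity

theorem hasSum_coeff_hypSeries :
    HasSum (fun n => ((coeff n hypSeries : ℚ) : ℝ)) (9 * √3 / (4 * π)) := by
  rw [hasSum_iff_tendsto_nat_of_nonneg fun n => by exact_mod_cast coeff_hypSeries_nonneg n]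
  refine (tendsto_add_atTop_iff_nat 1).1 (tendsto_partialProduct.congr fun n => ?_)
  rw [sum_coeff_hypSeries]

theorem cast_eval_ascPochhammer (q : ℚ) (n : ℕ) :
    (((ascPochhammer ℚ n).eval q : ℚ) : ℝ) = (ascPochhammer ℝ n).eval (q : ℝ) := by
  induction n with
  | zero => simp
  | succ n ih => rw [ascPochhammer_succ_eval, ascPochhammer_succ_eval, ← ih]; push_cast; ring

theorem ordinaryHypergeometric_one :
    ₂F₁ (1 / 3 : ℝ) (2 / 3 : ℝ) (2 : ℝ) (1 : ℝ) = 9 * √3 / (4 * π) := by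
  rw [ordinaryHypergeometric_eq_tsum, ← hasSum_coeff_hypSeries.tsum_eq]
  refine tsum_congr fun n => ?_
  rw [hypSeries, coeff_mk, ordinaryHypergeometricCoefficient]
  push_cast [cast_eval_ascPochhammer]
  simp

end

/-! ### Evaluating power series -/

section

open PowerSeries

/-- The rational power series `P` converges absolutely at the complex number `x`, with sum `y`. -/
def EvaluatesTo (P : ℚ⟦X⟧) (x y : ℂ) : Prop :=
  Summable (fun n => ‖((coeff n P : ℚ) : ℂ) * x ^ n‖) ∧
    HasSum (fun n => ((coeff n P : ℚ) : ℂ) * x ^ n) y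

namespace EvaluatesTo

theorem of_finite {P : ℚ⟦X⟧} {x y : ℂ} (s : Finset ℕ) (h : ∀ n ∉ s, coeff n P = 0)
    (hy : ∑ n ∈ s, ((coeff n P : ℚ) : ℂ) * x ^ n = y) : EvaluatesTo P x y :=
  ⟨summable_of_ne_finset_zero (s := s) fun n hn => by simp [h n hn],
    hy ▸ hasSum_sum_of_ne_finset_zero fun n hn => by simp [h n hn]⟩

theorem const (q : ℚ) (x : ℂ) : EvaluatesTo (C q) x q :=
  of_finite {0} (fun n hn => by rw [coeff_C, if_neg (by simpa using hn)]) (by simp)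

theorem var (x : ℂ) : EvaluatesTo X x x :=
  of_finite {1} (fun n hn => by rw [coeff_X, if_neg (by simpa using hn)]) (by simp)

theorem add {P Q : ℚ⟦X⟧} {x y z : ℂ} (hP : EvaluatesTo P x y) (hQ : EvaluatesTo Q x z) :
    EvaluatesTo (P + Q) x (y + z) := by
  have h : ∀ n, ((coeff n (P + Q) : ℚ) : ℂ) * x ^ n =
      ((coeff n P : ℚ) : ℂ) * x ^ n + ((coeff n Q : ℚ) : ℂ) * x ^ n := fun n => by
    rw [map_add]
    push_cast
    ring
  simp only [EvaluatesTo, h]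
  exact ⟨(hP.1.add hQ.1).of_nonneg_of_le (fun _ => norm_nonneg _) fun _ => norm_add_le _ _,
    hP.2.add hQ.2⟩

theorem mul {P Q : ℚ⟦X⟧} {x y z : ℂ} (hP : EvaluatesTo P x y) (hQ : EvaluatesTo Q x z) :
    EvaluatesTo (P * Q) x (y * z) := by
  have h : ∀ n, ((coeff n (P * Q) : ℚ) : ℂ) * x ^ n = ∑ kl ∈ Finset.HasAntidiagonal.antidiagonal n,
      ((coeff kl.1 P : ℚ) : ℂ) * x ^ kl.1 * (((coeff kl.2 Q : ℚ) : ℂ) * x ^ kl.2) := fun n => by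
    rw [coeff_mul]
    push_cast
    rw [Finset.sum_mul]
    refine Finset.sum_congr rfl fun kl hkl => ?_
    rw [← Finset.HasAntidiagonal.mem_antidiagonal.1 hkl, pow_add]
    ring
  have hs := summable_norm_sum_mul_antidiagonal_of_summable_norm hP.1 hQ.1
  simp only [EvaluatesTo, h]
  refine ⟨hs, ?_⟩
  rw [← hP.2.tsum_eq, ← hQ.2.tsum_eq,
    tsum_mul_tsum_eq_tsum_sum_antidiagonal_of_summable_norm hP.1 hQ.1]
  exact hs.of_norm.hasSum

theorem pow {P : ℚ⟦X⟧} {x y : ℂ} (hP : EvaluatesTo P x y) (k : ℕ) :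
    EvaluatesTo (P ^ k) x (y ^ k) := by
  induction k with
  | zero => simpa using const 1 x
  | succ k ih => rw [pow_succ, pow_succ]; exact ih.mul hP

theorem geomSeries {r : ℚ} {x : ℂ} (h : ‖(r : ℂ) * x‖ < 1) :
    EvaluatesTo (Rook3D.geomSeries r) x (1 - r * x)⁻¹ := by
  have h1 : ∀ n, ((coeff n (Rook3D.geomSeries r) : ℚ) : ℂ) * x ^ n = (r * x) ^ n := fun n => by
    rw [Rook3D.geomSeries, coeff_mk, mul_pow]
    push_cast
    rfl
  simp only [EvaluatesTo, h1]
  exact ⟨summable_norm_geometric_of_norm_lt_one h, hasSum_geometric_of_norm_lt_one h⟩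

/-- Composition: for nonnegative coefficients the double series converges absolutely as soon as the
outer series converges at the value of the inner one at `‖x‖`. -/
theorem subst {f φ : ℚ⟦X⟧} (hf : ∀ n, 0 ≤ coeff n f) (hφ : ∀ k n, 0 ≤ coeff n (φ ^ k))
    (hsub : HasSubst φ) {x z w : ℂ} {t : ℝ} (ht : EvaluatesTo φ (‖x‖ : ℂ) t)
    (hft : Summable fun k => ((coeff k f : ℚ) : ℝ) * t ^ k) (hx : EvaluatesTo φ x z)
    (hw : HasSum (fun k => ((coeff k f : ℚ) : ℂ) * z ^ k) w) :
    EvaluatesTo (f.subst φ) x w := by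
  have hnorm : ∀ k n, ‖((coeff n (φ ^ k) : ℚ) : ℂ) * x ^ n‖ =
      ((coeff n (φ ^ k) : ℚ) : ℝ) * ‖x‖ ^ n := fun k n => by
    have : (0 : ℝ) ≤ ((coeff n (φ ^ k) : ℚ) : ℝ) := by exact_mod_cast hφ k n
    rw [norm_mul, norm_pow, ← Complex.ofReal_ratCast, Complex.norm_of_nonneg this]
  have hpow : ∀ k, HasSum (fun n => ‖((coeff n (φ ^ k) : ℚ) : ℂ) * x ^ n‖) (t ^ k) := fun k => by
    have h1 := (ht.pow k).2
    rw [← Complex.hasSum_ofReal]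
    convert h1 using 1
    · ext n
      rw [hnorm]
      push_cast
      rfl
    · push_cast
      rfl
  let F : ℕ × ℕ → ℂ := fun p =>
    ((coeff p.1 f : ℚ) : ℂ) * (((coeff p.2 (φ ^ p.1) : ℚ) : ℂ) * x ^ p.2)
  have hFnorm : ∀ k n, ‖F (k, n)‖ =
      ((coeff k f : ℚ) : ℝ) * ‖((coeff n (φ ^ k) : ℚ) : ℂ) * x ^ n‖ := fun k n => by
    have : (0 : ℝ) ≤ ((coeff k f : ℚ) : ℝ) := by exact_mod_cast hf k
    rw [norm_mul, ← Complex.ofReal_ratCast, Complex.norm_of_nonneg this]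
  have hFs : Summable fun p => ‖F p‖ := by
    rw [summable_prod_of_nonneg fun p => norm_nonneg (F p)]
    simp only [hFnorm]
    refine ⟨fun k => (hpow k).summable.mul_left _, ?_⟩
    simpa only [tsum_mul_left, (hpow _).tsum_eq] using hft
  have hFsum : HasSum F w := by
    have h1 := hFs.of_norm.hasSum
    have h2 := h1.prod_fiberwise fun k => (hx.pow k).2.mul_left ((coeff k f : ℚ) : ℂ)
    rwa [h2.unique hw] at h1
  have hcoeff : ∀ n, HasSum (fun k => F (k, n)) (((coeff n (f.subst φ) : ℚ) : ℂ) * x ^ n) := by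
    intro n
    have hfin := coeff_subst_finite' hsub f n
    rw [coeff_subst' hsub, finsum_eq_sum _ hfin]
    push_cast
    rw [Finset.sum_mul]
    have h1 : HasSum (fun k => F (k, n)) (∑ k ∈ hfin.toFinset, F (k, n)) :=
      hasSum_sum_of_ne_finset_zero fun k hk => by
        have h0 : coeff k f • coeff n (φ ^ k) = 0 := by
          simpa [or_iff_not_imp_left] using hk
        have h1 : ((coeff k f : ℚ) : ℂ) * ((coeff n (φ ^ k) : ℚ) : ℂ) = 0 := by
          exact_mod_cast h0
        simp only [F, ← mul_assoc, h1, zero_mul]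
    convert h1 using 1
    refine Finset.sum_congr rfl fun k _ => ?_
    simp only [F, smul_eq_mul]
    push_cast
    ring
  have hswap := (Equiv.prodComm ℕ ℕ).hasSum_iff.2 hFsum
  have hswapn := (Equiv.prodComm ℕ ℕ).summable_iff.2 hFs
  refine ⟨?_, hswap.prod_fiberwise hcoeff⟩
  have h3 := ((summable_prod_of_nonneg fun p => norm_nonneg _).1 hswapn).2
  refine h3.of_nonneg_of_le (fun _ => norm_nonneg _) fun n => ?_
  rw [← (hcoeff n).tsum_eq]
  exact norm_tsum_le_tsum_norm (((summable_prod_of_nonneg fun p => norm_nonneg _).1 hswapn).1 n)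

end EvaluatesTo

end

/-! ### The closed form on the closed disc of convergence -/

section

open PowerSeries

theorem coeff_mul_nonneg {P Q : ℚ⟦X⟧} (hP : ∀ n, 0 ≤ coeff n P) (hQ : ∀ n, 0 ≤ coeff n Q)
    (n : ℕ) : 0 ≤ coeff n (P * Q) := by
  rw [coeff_mul]
  exact Finset.sum_nonneg fun kl _ => mul_nonneg (hP _) (hQ _)

theorem coeff_C_nonneg {q : ℚ} (hq : 0 ≤ q) (n : ℕ) : 0 ≤ coeff n (C q) := by
  rw [coeff_C]
  split_ifs <;> simp [hq]

theorem coeff_X_nonneg (n : ℕ) : 0 ≤ coeff n (X : ℚ⟦X⟧) := by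
  rw [coeff_X]
  split_ifs <;> simp

theorem coeff_pow_nonneg {P : ℚ⟦X⟧} (hP : ∀ n, 0 ≤ coeff n P) (k n : ℕ) :
    0 ≤ coeff n (P ^ k) := by
  induction k generalizing n with
  | zero => simpa using coeff_C_nonneg zero_le_one n
  | succ k ih => rw [pow_succ]; exact coeff_mul_nonneg ih hP n

theorem coeff_geomSeries_nonneg {r : ℚ} (hr : 0 ≤ r) (n : ℕ) : 0 ≤ coeff n (geomSeries r) := by
  rw [geomSeries, coeff_mk]
  positivity

theorem coeff_argSeries_nonneg (n : ℕ) : 0 ≤ coeff n argSeries := by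
  have hg := coeff_geomSeries_nonneg (r := 4) (by norm_num)
  refine coeff_mul_nonneg (coeff_mul_nonneg (coeff_mul_nonneg (coeff_C_nonneg (by norm_num))
    coeff_X_nonneg) (coeff_pow_nonneg hg 2)) (fun n => ?_) n
  rw [map_add]
  exact add_nonneg (coeff_C_nonneg (by norm_num) n)
    (coeff_mul_nonneg (coeff_mul_nonneg (coeff_C_nonneg (by norm_num)) coeff_X_nonneg) hg n)

/-- The sum of `hypSeries`, as a function on the closed unit disc. -/
noncomputable def hypFun (z : ℂ) : ℂ := ∑' k, ((coeff k hypSeries : ℚ) : ℂ) * z ^ k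

theorem norm_hypSeries_term_le {z : ℂ} (hz : ‖z‖ ≤ 1) (k : ℕ) :
    ‖((coeff k hypSeries : ℚ) : ℂ) * z ^ k‖ ≤ ((coeff k hypSeries : ℚ) : ℝ) := by
  have h : (0 : ℝ) ≤ ((coeff k hypSeries : ℚ) : ℝ) := by exact_mod_cast coeff_hypSeries_nonneg k
  rw [norm_mul, norm_pow, ← Complex.ofReal_ratCast, Complex.norm_of_nonneg h]
  exact mul_le_of_le_one_right h (pow_le_one₀ (norm_nonneg z) hz)

theorem hasSum_hypFun {z : ℂ} (hz : ‖z‖ ≤ 1) :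
    HasSum (fun k => ((coeff k hypSeries : ℚ) : ℂ) * z ^ k) (hypFun z) :=
  (hasSum_coeff_hypSeries.summable.of_norm_bounded (norm_hypSeries_term_le hz)).hasSum

theorem continuousOn_hypFun : ContinuousOn hypFun (Metric.closedBall 0 1) :=
  continuousOn_tsum (fun k => by fun_prop) hasSum_coeff_hypSeries.summable
    fun k z hz => norm_hypSeries_term_le (by simpa using hz) k

theorem analyticAt_hypFun {z : ℂ} (hz : ‖z‖ < 1) : AnalyticAt ℂ hypFun z := by
  have h : DifferentiableOn ℂ hypFun (Metric.ball 0 1) :=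
    Complex.differentiableOn_tsum_of_summable_norm hasSum_coeff_hypSeries.summable
      (fun k => by fun_prop) Metric.isOpen_ball
      fun k w hw => norm_hypSeries_term_le (by simpa using (Metric.mem_ball.1 hw).le) k
  exact h.analyticAt (Metric.isOpen_ball.mem_nhds (by simpa using hz))

theorem hypFun_one : hypFun 1 = ((9 * √3 / (4 * π) : ℝ) : ℂ) := by
  have h1 := hasSum_hypFun (z := 1) (by simp)
  refine h1.unique ?_
  convert Complex.hasSum_ofReal.2 hasSum_coeff_hypSeries using 2
  simp

/-- The sum of `argSeries`. -/
noncomputable def argFun (x : ℂ) : ℂ :=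
  27 * x * (1 - 4 * x)⁻¹ ^ 2 * (2 + 5 * x * (1 - 4 * x)⁻¹)

theorem evaluatesTo_geomSeries_four {x : ℂ} (hx : ‖x‖ ≤ 1 / 64) :
    EvaluatesTo (geomSeries 4) x (1 - 4 * x)⁻¹ := by
  have h := EvaluatesTo.geomSeries (r := 4) (x := x) (by
    rw [norm_mul]
    norm_num
    linarith)
  simpa using h

theorem evaluatesTo_argSeries {x : ℂ} (hx : ‖x‖ ≤ 1 / 64) :
    EvaluatesTo argSeries x (argFun x) := by
  have hg := evaluatesTo_geomSeries_four hx
  have h := (((EvaluatesTo.const 27 x).mul (.var x)).mul (hg.pow 2)).mul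
    ((EvaluatesTo.const 2 x).add (((EvaluatesTo.const 5 x).mul (.var x)).mul hg))
  simpa [argFun, argSeries] using h

theorem one_sub_four_mul_re {x : ℂ} : (1 - 4 * x).re = 1 - 4 * x.re := by simp

theorem norm_one_sub_four_mul_ge {x : ℂ} (hx : ‖x‖ ≤ 1 / 64) : 15 / 16 ≤ ‖1 - 4 * x‖ := by
  have h1 := Complex.re_le_norm (1 - 4 * x)
  have h2 := Complex.re_le_norm x
  rw [one_sub_four_mul_re] at h1
  linarith

theorem one_sub_four_mul_ne_zero {x : ℂ} (hx : ‖x‖ ≤ 1 / 64) : 1 - 4 * x ≠ 0 := by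
  have := norm_one_sub_four_mul_ge hx
  rw [← norm_pos_iff]
  linarith

theorem re_lt_of_norm_le {x : ℂ} {r : ℝ} (hx : ‖x‖ ≤ r) (hne : x ≠ r) : x.re < r := by
  refine lt_of_le_of_ne ((Complex.re_le_norm x).trans hx) fun h => hne ?_
  have h1 : ‖x‖ ^ 2 = x.re ^ 2 + x.im ^ 2 := by
    rw [Complex.sq_norm, Complex.normSq_apply]
    ring
  have h2 : x.im ^ 2 ≤ 0 := by
    have := pow_le_pow_left₀ (norm_nonneg x) hx 2
    rw [h1, h] at this
    linarith
  have h3 : x.im = 0 := by simpa using le_antisymm h2 (sq_nonneg _)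
  exact Complex.ext (by simpa using h) (by simpa using h3)

theorem norm_argFun_le (x : ℂ) : ‖argFun x‖ ≤
    27 * ‖x‖ * ‖1 - 4 * x‖⁻¹ ^ 2 * (2 + 5 * ‖x‖ * ‖1 - 4 * x‖⁻¹) := by
  rw [argFun, norm_mul, norm_mul, norm_mul, norm_pow, norm_inv, Complex.norm_ofNat]
  gcongr
  refine (norm_add_le _ _).trans ?_
  rw [norm_mul, norm_mul, norm_inv, Complex.norm_ofNat, Complex.norm_ofNat]

theorem norm_argFun_le_one {x : ℂ} (hx : ‖x‖ ≤ 1 / 64) : ‖argFun x‖ ≤ 1 := by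
  have h1 : ‖1 - 4 * x‖⁻¹ ≤ 16 / 15 := by
    rw [inv_le_comm₀ (by linarith [norm_one_sub_four_mul_ge hx]) (by norm_num)]
    simpa using norm_one_sub_four_mul_ge hx
  calc ‖argFun x‖ ≤ 27 * ‖x‖ * ‖1 - 4 * x‖⁻¹ ^ 2 * (2 + 5 * ‖x‖ * ‖1 - 4 * x‖⁻¹) :=
        norm_argFun_le x
    _ ≤ 27 * (1 / 64) * (16 / 15) ^ 2 * (2 + 5 * (1 / 64) * (16 / 15)) := by gcongr
    _ = 1 := by norm_num

/-- The point `1 / 64` is the only one of the closed disc that the substitution sends to the unit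
circle: this is why it is the only singularity. -/
theorem norm_argFun_lt_one {x : ℂ} (hx : ‖x‖ ≤ 1 / 64) (hne : x ≠ 1 / 64) : ‖argFun x‖ < 1 := by
  have h0 : 15 / 16 < ‖1 - 4 * x‖ := by
    have h1 := Complex.re_le_norm (1 - 4 * x)
    have h2 := re_lt_of_norm_le hx (by simpa using hne)
    rw [one_sub_four_mul_re] at h1
    linarith
  have h1 : ‖1 - 4 * x‖⁻¹ < 16 / 15 := by
    rw [inv_lt_comm₀ (by linarith) (by norm_num)]
    simpa using h0
  calc ‖argFun x‖ ≤ 27 * ‖x‖ * ‖1 - 4 * x‖⁻¹ ^ 2 * (2 + 5 * ‖x‖ * ‖1 - 4 * x‖⁻¹) :=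
        norm_argFun_le x
    _ ≤ 27 * (1 / 64) * ‖1 - 4 * x‖⁻¹ ^ 2 * (2 + 5 * (1 / 64) * (16 / 15)) := by gcongr
    _ < 27 * (1 / 64) * (16 / 15) ^ 2 * (2 + 5 * (1 / 64) * (16 / 15)) := by gcongr
    _ = 1 := by norm_num

/-- The sum of `numeratorSeries`. -/
noncomputable def numeratorFun (x : ℂ) : ℂ := 6 * hypFun (argFun x) * (1 - 4 * x)⁻¹

theorem evaluatesTo_numeratorSeries {x : ℂ} (hx : ‖x‖ ≤ 1 / 64) :
    EvaluatesTo numeratorSeries x (numeratorFun x) := by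
  obtain ⟨t, ht⟩ : ∃ t : ℝ, t =
    27 * ‖x‖ * (1 - 4 * ‖x‖)⁻¹ ^ 2 * (2 + 5 * ‖x‖ * (1 - 4 * ‖x‖)⁻¹) := ⟨_, rfl⟩
  have htc : argFun (‖x‖ : ℂ) = t := by
    rw [ht, argFun]
    push_cast
    rfl
  have hx' : ‖(‖x‖ : ℂ)‖ ≤ 1 / 64 := by simpa using hx
  have ht0 : 0 ≤ t := by
    have : 0 < 1 - 4 * ‖x‖ := by linarith
    rw [ht]
    positivity
  have ht1 : t ≤ 1 := by
    have := norm_argFun_le_one hx'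
    rwa [htc, Complex.norm_of_nonneg ht0] at this
  have hsub : EvaluatesTo (hypSeries.subst argSeries) x (hypFun (argFun x)) := by
    refine EvaluatesTo.subst (t := t) coeff_hypSeries_nonneg
      (coeff_pow_nonneg coeff_argSeries_nonneg) hasSubst_argSeries
      (htc ▸ evaluatesTo_argSeries hx') ?_ (evaluatesTo_argSeries hx)
      (hasSum_hypFun (norm_argFun_le_one hx))
    have h0 : ∀ k, (0 : ℝ) ≤ ((coeff k hypSeries : ℚ) : ℝ) := fun k => by
      exact_mod_cast coeff_hypSeries_nonneg k
    exact hasSum_coeff_hypSeries.summable.of_nonneg_of_le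
      (fun k => mul_nonneg (h0 k) (pow_nonneg ht0 k))
      fun k => mul_le_of_le_one_right (h0 k) (pow_le_one₀ ht0 ht1)
  have h := ((EvaluatesTo.const 6 x).mul hsub).mul (evaluatesTo_geomSeries_four hx)
  simpa [numeratorFun, numeratorSeries] using h

theorem argFun_one_div : argFun (1 / 64) = 1 := by
  norm_num [argFun]

theorem numeratorFun_one_div : numeratorFun (1 / 64) = ((72 * √3 / (5 * π) : ℝ) : ℂ) := by
  rw [numeratorFun, argFun_one_div, hypFun_one]
  have hπ : (π : ℂ) ≠ 0 := by exact_mod_cast Real.pi_ne_zero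
  push_cast
  field_simp
  norm_num

theorem analyticAt_argFun {x : ℂ} (hx : ‖x‖ ≤ 1 / 64) : AnalyticAt ℂ argFun x := by
  have h := one_sub_four_mul_ne_zero hx
  unfold argFun
  fun_prop (disch := assumption)

theorem continuousOn_numeratorFun : ContinuousOn numeratorFun (Metric.closedBall 0 (1 / 64)) := by
  have hball : ∀ x ∈ Metric.closedBall (0 : ℂ) (1 / 64), ‖x‖ ≤ 1 / 64 := fun x hx => by
    simpa using hx
  have h1 : ContinuousOn argFun (Metric.closedBall 0 (1 / 64)) := fun x hx =>
    (analyticAt_argFun (hball x hx)).continuousAt.continuousWithinAt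
  have h2 : ContinuousOn (fun x : ℂ => (1 - 4 * x)⁻¹) (Metric.closedBall 0 (1 / 64)) :=
    ContinuousOn.inv₀ (by fun_prop) fun x hx => one_sub_four_mul_ne_zero (hball x hx)
  exact (continuousOn_const.mul (continuousOn_hypFun.comp h1 fun x hx => by
    simpa using norm_argFun_le_one (hball x hx))).mul h2

theorem analyticAt_numeratorFun {x : ℂ} (hx : ‖x‖ ≤ 1 / 64) (hne : x ≠ 1 / 64) :
    AnalyticAt ℂ numeratorFun x := by
  have h := one_sub_four_mul_ne_zero hx
  have h1 : AnalyticAt ℂ (fun x => hypFun (argFun x)) x :=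
    (analyticAt_hypFun (norm_argFun_lt_one hx hne)).fun_comp (analyticAt_argFun hx)
  have h2 : AnalyticAt ℂ (fun x : ℂ => (1 - 4 * x)⁻¹) x := by fun_prop (disch := assumption)
  exact (analyticAt_const.mul h1).mul h2

end

/-! ### Coefficient asymptotics and the dominant singularity -/

section

open PowerSeries

theorem h_eq_sum (n : ℕ) :
    h n = ∑ k ∈ Finset.range (n + 1), coeff k numeratorSeries * 64 ^ (n - k) := by
  rw [h, derivative_G_eq, coeff_mul, Finset.Nat.sum_antidiagonal_eq_sum_range_succ
    fun i j => coeff i numeratorSeries * coeff j (geomSeries 64)]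
  simp [geomSeries]

theorem h_div_pow_eq_sum (n : ℕ) : (h n : ℝ) / 64 ^ n =
    ∑ k ∈ Finset.range (n + 1), ((coeff k numeratorSeries : ℚ) : ℝ) * (1 / 64) ^ k := by
  rw [h_eq_sum]
  push_cast
  rw [Finset.sum_div]
  refine Finset.sum_congr rfl fun k hk => ?_
  have h1 : (64 : ℝ) ^ n = 64 ^ k * 64 ^ (n - k) := by
    rw [← pow_add, Nat.add_sub_cancel' (Nat.lt_succ_iff.1 (Finset.mem_range.1 hk))]
  rw [h1, one_div_pow]
  field_simp

theorem hasSum_numeratorSeries :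
    HasSum (fun k => ((coeff k numeratorSeries : ℚ) : ℝ) * (1 / 64) ^ k) (72 * √3 / (5 * π)) := by
  have h1 := (evaluatesTo_numeratorSeries (x := 1 / 64) (by norm_num)).2
  rw [numeratorFun_one_div] at h1
  rw [← Complex.hasSum_ofReal]
  convert h1 using 2
  push_cast
  rfl

theorem tendsto_h_div_pow :
    Tendsto (fun n => (h n : ℝ) / 64 ^ n) atTop (𝓝 (72 * √3 / (5 * π))) := by
  simp only [h_div_pow_eq_sum]
  exact (tendsto_add_atTop_iff_nat 1).2 hasSum_numeratorSeries.tendsto_sum_nat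

theorem residue_pos : 0 < 72 * √3 / (5 * π) := by
  have := Real.pi_pos
  positivity

theorem isEquivalent_h :
    (fun n : ℕ => (h n : ℝ)) ~[atTop] fun n : ℕ => 72 * √3 / (5 * π) * (64 : ℝ) ^ n := by
  refine isEquivalent_of_tendsto_one ?_
  have h1 := tendsto_h_div_pow.div_const (72 * √3 / (5 * π))
  rw [div_self residue_pos.ne'] at h1
  refine h1.congr fun n => ?_
  simp only [Pi.div_apply]
  rw [div_div, mul_comm]

theorem isEquivalent_a : (fun n : ℕ => (a n : ℝ)) ~[atTop]
    fun n : ℕ => 9 * √3 / (40 * π) * ((64 : ℝ) ^ n / (n : ℝ)) := by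
  refine isEquivalent_of_tendsto_one ((tendsto_add_atTop_iff_nat 1).1 ?_)
  have h1 := tendsto_h_div_pow.div_const (72 * √3 / (5 * π))
  rw [div_self residue_pos.ne'] at h1
  refine h1.congr fun n => ?_
  have h2 : (h n : ℝ) = (n + 1) * a (n + 1) := by
    rw [h, coeff_derivative_G]
    push_cast
    rfl
  have hπ := Real.pi_ne_zero
  simp only [Pi.div_apply]
  rw [h2]
  push_cast
  field_simp
  ring

theorem hasSum_h {x : ℂ} (hx : ‖x‖ < 1 / 64) :
    HasSum (fun n => (h n : ℂ) * x ^ n) (numeratorFun x * (1 - 64 * x)⁻¹) := by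
  have hg := EvaluatesTo.geomSeries (r := 64) (x := x) (by
    rw [norm_mul]
    norm_num
    linarith)
  have h1 := ((evaluatesTo_numeratorSeries hx.le).mul hg).2
  rw [← derivative_G_eq] at h1
  simpa [h] using h1

theorem one_sub_mul_ne_zero {x : ℂ} (hx : x ≠ 1 / 64) : 1 - 64 * x ≠ 0 := fun h0 =>
  hx (by linear_combination (-1 / 64 : ℂ) * h0)

theorem tendsto_numeratorFun : Tendsto numeratorFun (𝓝[Metric.ball 0 (1 / 64)] (1 / 64))
    (𝓝 ((72 * √3 / (5 * π) : ℝ) : ℂ)) := by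
  rw [← numeratorFun_one_div]
  exact (continuousOn_numeratorFun (1 / 64) (by simp)).mono_left
    (nhdsWithin_mono _ Metric.ball_subset_closedBall)

theorem norm_lt_and_ne_of_mem_ball {x : ℂ} (hx : x ∈ Metric.ball (0 : ℂ) (1 / 64)) :
    ‖x‖ < 1 / 64 ∧ x ≠ 1 / 64 := by
  have h1 : ‖x‖ < 1 / 64 := by simpa using hx
  refine ⟨h1, ?_⟩
  rintro rfl
  norm_num at h1

theorem tendsto_residue :
    Tendsto (fun x : ℂ => (1 - 64 * x) * ∑' n : ℕ, (h n : ℂ) * x ^ n)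
      (𝓝[Metric.ball 0 (1 / 64)] (1 / 64)) (𝓝 ((72 * √3 / (5 * π) : ℝ) : ℂ)) := by
  refine tendsto_numeratorFun.congr' ?_
  filter_upwards [self_mem_nhdsWithin] with x hx
  obtain ⟨h1, h2⟩ := norm_lt_and_ne_of_mem_ball hx
  rw [(hasSum_h h1).tsum_eq]
  have := one_sub_mul_ne_zero h2
  field_simp

theorem neBot_nhdsWithin_ball : (𝓝[Metric.ball (0 : ℂ) (1 / 64)] (1 / 64)).NeBot := by
  rw [← mem_closure_iff_nhdsWithin_neBot, closure_ball _ (by norm_num)]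
  simp

/-- An analytic continuation to `1 / 64` would make `(1 - 64 x) G'(x)` tend to zero there. -/
theorem not_extendsAnalyticallyAt :
    ¬ ExtendsAnalyticallyAt (fun n => (h n : ℂ)) (1 / 64) := by
  rintro ⟨g, hg, hev⟩
  have := neBot_nhdsWithin_ball
  have h1 : Tendsto (fun x : ℂ => (1 - 64 * x) * g x) (𝓝[Metric.ball 0 (1 / 64)] (1 / 64))
      (𝓝 ((1 - 64 * (1 / 64)) * g (1 / 64))) :=
    (ContinuousAt.mul (by fun_prop) hg.continuousAt).tendsto.mono_left nhdsWithin_le_nhds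
  have h2 : Tendsto (fun x : ℂ => (1 - 64 * x) * g x) (𝓝[Metric.ball 0 (1 / 64)] (1 / 64))
      (𝓝 ((72 * √3 / (5 * π) : ℝ) : ℂ)) := by
    refine tendsto_residue.congr' ?_
    filter_upwards [self_mem_nhdsWithin, nhdsWithin_le_nhds hev] with x hx hx'
    rw [(hx' (by simpa using hx)).tsum_eq]
  have h3 := tendsto_nhds_unique h1 h2
  rw [show (1 - 64 * (1 / 64) : ℂ) = 0 by norm_num, zero_mul] at h3
  exact residue_pos.ne (by exact_mod_cast h3)

theorem extendsAnalyticallyAt {ζ : ℂ} (hζ : ‖ζ‖ = 1 / 64) (hne : ζ ≠ 1 / 64) :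
    ExtendsAnalyticallyAt (fun n => (h n : ℂ)) ζ := by
  refine ⟨fun x => numeratorFun x * (1 - 64 * x)⁻¹, ?_, ?_⟩
  · have h1 := one_sub_mul_ne_zero hne
    have h2 : AnalyticAt ℂ (fun x : ℂ => (1 - 64 * x)⁻¹) ζ := by fun_prop (disch := assumption)
    exact (analyticAt_numeratorFun hζ.le hne).mul h2
  · exact Eventually.of_forall fun z hz => hasSum_h (hζ ▸ hz)

theorem radius_ofScalars_h : (FormalMultilinearSeries.ofScalars ℂ fun n => (h n : ℂ)).radius =
    ENNReal.ofReal (1 / 64) := by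
  have hnorm : ∀ n, ‖FormalMultilinearSeries.ofScalars ℂ (fun n => (h n : ℂ)) n‖ * (1 / 64) ^ n =
      |(h n : ℝ) / 64 ^ n| := fun n => by
    rw [FormalMultilinearSeries.ofScalars_norm, ← Complex.ofReal_ratCast, Complex.norm_real,
      Real.norm_eq_abs, abs_div, abs_of_pos (by positivity : (0 : ℝ) < 64 ^ n), one_div_pow,
      mul_one_div]
  have htend := tendsto_h_div_pow.abs
  refine le_antisymm (le_of_not_gt fun hlt => ?_) ?_
  · have h1 := FormalMultilinearSeries.summable_norm_mul_pow _ (r := Real.toNNReal (1 / 64)) hlt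
    rw [Real.coe_toNNReal _ (by norm_num)] at h1
    simp only [hnorm] at h1
    have h2 := tendsto_nhds_unique h1.tendsto_atTop_zero htend
    exact (abs_pos.2 residue_pos.ne').ne h2
  · obtain ⟨B, hB⟩ := htend.bddAbove_range
    refine FormalMultilinearSeries.le_radius_of_bound _ B (r := Real.toNNReal (1 / 64)) fun n => ?_
    rw [Real.coe_toNNReal _ (by norm_num), hnorm]
    exact hB ⟨n, rfl⟩

theorem isDominantSingularity_h : IsDominantSingularity (fun n => (h n : ℂ)) (1 / 64) := by
  have hn : ‖(1 / 64 : ℂ)‖ = 1 / 64 := by norm_num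
  rw [IsDominantSingularity, hn]
  refine ⟨radius_ofScalars_h, fun ζ hζ => ⟨fun hs => ?_, fun heq => ?_⟩⟩
  · by_contra hne
    exact hs (extendsAnalyticallyAt hζ hne)
  · rw [heq]
    exact not_extendsAnalyticallyAt

theorem residue_eq :
    32 / 5 * ₂F₁ (1 / 3 : ℝ) (2 / 3 : ℝ) (2 : ℝ) (1 : ℝ) = 72 * √3 / (5 * π) := by
  rw [ordinaryHypergeometric_one]
  have := Real.pi_ne_zero
  field_simp
  norm_num

end

end Rook3D

theorem mainTheorem4 :
    -- the asymptotics of the number of diagonal rook paths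
    (fun n : ℕ => (Rook3D.a n : ℝ)) ~[atTop]
      (fun n : ℕ => 9 * √3 / (40 * π) * ((64 : ℝ) ^ n / (n : ℝ))) ∧
    -- the dominant singularity of `∂_x G`
    Rook3D.IsDominantSingularity (fun n : ℕ => (Rook3D.h n : ℂ)) (1 / 64) ∧
    -- the residue there, as the coefficient of `1 / (1 - 64 x)`
    Tendsto (fun x : ℂ => (1 - 64 * x) * ∑' n : ℕ, (Rook3D.h n : ℂ) * x ^ n)
      (𝓝[Metric.ball 0 (1 / 64)] (1 / 64))
      (𝓝 (((32 / 5 * ₂F₁ (1 / 3 : ℝ) (2 / 3 : ℝ) (2 : ℝ) (1 : ℝ) : ℝ)) : ℂ)) ∧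
    -- the asymptotics of the coefficients of `∂_x G`
    (fun n : ℕ => (Rook3D.h n : ℝ)) ~[atTop]
      (fun n : ℕ => 32 / 5 * ₂F₁ (1 / 3 : ℝ) (2 / 3 : ℝ) (2 : ℝ) (1 : ℝ) * (64 : ℝ) ^ n) ∧
    -- the value of the residue
    32 / 5 * ₂F₁ (1 / 3 : ℝ) (2 / 3 : ℝ) (2 : ℝ) (1 : ℝ) = 72 * √3 / (5 * π) := by
  rw [Rook3D.residue_eq]
  exact ⟨Rook3D.isEquivalent_a, Rook3D.isDominantSingularity_h, Rook3D.tendsto_residue,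
    Rook3D.isEquivalent_h, rfl⟩
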